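/- Let $k$ be a field, $S=k[x_1,\dots,x_n]$, and let $I\subseteq S$ be a Borel fixed monomial ideal, i.e. a monomial ideal such that whenever $m\in I$ is a monomial, $x_i\mid m$ and $j<i$, then $(x_j/x_i)\,m\in I$. Let $G(I)$ be the set of minimal monomial generators of $I$, let $d\ge 1$ be an integer with $\deg m\le d$ for all $m\in G(I)$ (for instance $d=\max\{\deg m\mid m\in G(I)\}$ when $0\neq I\neq S$), and put $$\widetilde S=k[x_{i,j}\mid 1\le i\le n,\ 1\le j\le d],\qquad \Theta=\{x_{i,1}-x_{i,j}\mid 1\le i\le n,\ 2\le j\le d\}\subset\widetilde S .$$ Let $\phi:\widetilde S\to S$ be the $k$-algebra map with $\phi(x_{i,j})=x_i$; it induces an isomorphism $\widetilde S/(\Theta)\cong S$. For an exponent vector $a\in\mathbb N^n$ with $\sum_i a_i\le d$ let $$\mathrm{pol}(x^a)=\prod_{i=1}^n x_{i,1}x_{i,2}\cdots x_{i,a_i},\qquad \mathrm{BoX}(x^a)=\prod_{i=1}^n\ \prod_{j=b_{i-1}+1}^{b_i}x_{i,j},\quad b_i=a_1+\dots+a_i .$$ For a subset $A\subseteq\{1,\dots,n\}$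 and a monomial $m=x^a$ of degree at most $d$ put $m_A=\prod_{i\in A}x_i^{a_i}$, $m_{-A}=\prod_{i\notin A}x_i^{a_i}$ and $$\mathrm{BoX}_A(m)=\mathrm{BoX}(m_A)\cdot\mathrm{pol}(m_{-A}),\qquad J=\mathrm{BoX}_A(I)=(\mathrm{BoX}_A(m)\mid m\in G(I))\subseteq\widetilde S .$$ Then for every $A\subseteq\{1,\dots,n\}$: 1. $\widetilde S/J$ has a pretty clean filtration, i.e. a chain of submodules $0=M_0\subseteq M_1\subseteq\dots\subseteq M_t=\widetilde S/J$ with $M_i/M_{i-1}\cong\widetilde S/\mathfrak p_i$ for prime ideals $\mathfrak p_i$, such that $i<j$ and $\mathfrak p_i\subseteq\mathfrak p_j$ imply $\mathfrak p_i=\mathfrak p_j$. 2. $J$ is a faithful polarization of $I$, that is: $J$ is a squarefree monomial ideal; $\phi$ induces an isomorphism $\widetilde S/(\Theta)\otimes_{\widetilde S}\widetilde S/J\cong S/I$; $\Theta$ forms an $\widetilde S/J$-regular sequence; and $\Theta$ forms an $\mathrm{Ext}^i_{\widetilde S}(\widetilde S/J,\widetilde S)$-regular sequence for all $i\ge 0$.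 Here a finite set forms an $M$-regular sequence if its elements, in any order, do; every sequence counts as regular on the zero module, while for $M\neq0$ the condition $M\neq(\Theta)M$ is included. -/

import Mathlib

open scoped TensorProduct

noncomputable section

namespace BoxPol

universe u

section MonomialIdeals

variable {k : Type u} [Field k] {σ : Type}

/-- An ideal of a polynomial ring that is generated by monomials `x^a`. -/
def IsMonomialIdeal (I : Ideal (MvPolynomial σ k)) : Prop :=
  ∃ s : Set (σ →₀ ℕ), I = Ideal.span ((fun a => MvPolynomial.monomial a (1 : k)) '' s)

/-- An ideal of a polynomial ring that is generated by squarefree monomials. -/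
def IsSquarefreeMonomialIdeal (J : Ideal (MvPolynomial σ k)) : Prop :=
  ∃ s : Set (σ →₀ ℕ), (∀ a ∈ s, ∀ v, a v ≤ 1) ∧
    J = Ideal.span ((fun a => MvPolynomial.monomial a (1 : k)) '' s)

/-- The exponent vectors of the minimal monomial generators `G(I)` of a monomial ideal `I`: the
monomials in `I` that are minimal for divisibility. -/
def minGens (I : Ideal (MvPolynomial σ k)) : Set (σ →₀ ℕ) :=
  {a | Minimal (fun b : σ →₀ ℕ => MvPolynomial.monomial b (1 : k) ∈ I) a}

/-- `I` is a Borel fixed (strongly stable) monomial ideal: if `m ∈ I` is a monomial, `x_i ∣ m` and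
`j < i`, then `(x_j / x_i) m ∈ I`. -/
def IsBorelFixed {n : ℕ} (I : Ideal (MvPolynomial (Fin n) k)) : Prop :=
  IsMonomialIdeal I ∧
    ∀ (a : Fin n →₀ ℕ) (i j : Fin n), MvPolynomial.monomial a (1 : k) ∈ I → 0 < a i → j < i →
      MvPolynomial.monomial (a - Finsupp.single i 1 + Finsupp.single j 1) (1 : k) ∈ I

end MonomialIdeals

section RegularSequences

variable {R : Type*} [CommRing R]

/-- The finite set `T` forms an `M`-regular sequence, whatever the order in which its elements are
listed. As usual every sequence is regarded as regular on the zero module; on a nonzero module `M`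
the condition `M ≠ T M` is part of the notion. -/
def FormsRegularSequence (T : Set R) (M : Type*) [AddCommGroup M] [Module R M] : Prop :=
  T.Finite ∧ ∀ l : List R, l.Nodup → (∀ r, r ∈ l ↔ r ∈ T) →
    Subsingleton M ∨ RingTheory.Sequence.IsRegular M l

/-- `M` has a pretty clean filtration: a prime filtration `0 = M_0 ⊆ M_1 ⊆ ⋯ ⊆ M_t = M` with
`M_i / M_{i-1} ≅ R / p_i` such that `i < j` and `p_i ⊆ p_j` imply `p_i = p_j`. -/
def HasPrettyCleanFiltration (R : Type*) [CommRing R] (M : Type*) [AddCommGroup M]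
    [Module R M] : Prop :=
  ∃ (t : ℕ) (N : Fin (t + 1) → Submodule R M) (p : Fin t → Ideal R),
    N 0 = ⊥ ∧ N (Fin.last t) = ⊤ ∧
    (∀ i : Fin t, N i.castSucc ≤ N i.succ ∧ (p i).IsPrime ∧
      Nonempty ((N i.succ ⧸ (N i.castSucc).submoduleOf (N i.succ)) ≃ₗ[R] (R ⧸ p i))) ∧
    ∀ i j : Fin t, i < j → p i ≤ p j → p i = p j

end RegularSequences

section Polarization

variable (k : Type u) [Field k] (n d : ℕ)

/-- The polynomial ring in the variables `x_{i,j}`, `1 ≤ i ≤ n`, `1 ≤ j ≤ d`. Both indices are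
shifted to start from `0`: the variable `x_{i,j}` is `X (i - 1, j - 1)`. -/
abbrev PolRing : Type u := MvPolynomial (Fin n × Fin d) k

/-- The set `Θ` of the linear forms `x_{i,1} - x_{i,j}` with `2 ≤ j ≤ d`. -/
def theta : Set (PolRing k n d) :=
  {f | ∃ (i : Fin n) (j₁ j : Fin d), j₁.val = 0 ∧ 0 < j.val ∧
    f = MvPolynomial.X (i, j₁) - MvPolynomial.X (i, j)}

/-- The `k`-algebra homomorphism `φ` with `φ (x_{i,j}) = x_i`. -/
def phi : PolRing k n d →ₐ[k] MvPolynomial (Fin n) k :=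
  MvPolynomial.aeval (fun v => MvPolynomial.X v.1)

variable {k n d}

/-- `J` is a polarization of `I`: a squarefree monomial ideal such that the isomorphism induced
by `φ` identifies `S̃/(Θ) ⊗ S̃/J` with `S/I`, and such that `Θ` forms an `S̃/J`-regular
sequence. -/
structure IsPolarization (I : Ideal (MvPolynomial (Fin n) k)) (J : Ideal (PolRing k n d)) :
    Prop where
  squarefree : IsSquarefreeMonomialIdeal J
  specialize : ∃ e : ((PolRing k n d ⧸ Ideal.span (theta k n d)) ⊗[PolRing k n d]
      (PolRing k n d ⧸ J)) ≃+* (MvPolynomial (Fin n) k ⧸ I),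
    ∀ f g : PolRing k n d,
      e (Ideal.Quotient.mk _ f ⊗ₜ[PolRing k n d] Ideal.Quotient.mk _ g) =
        Ideal.Quotient.mk I (phi k n d (f * g))
  regular : FormsRegularSequence (theta k n d) (PolRing k n d ⧸ J)

/-- A polarization `J` is faithful if `Θ` forms a regular sequence on `Ext^i(S̃/J, S̃)` for all
`i`. -/
structure IsFaithfulPolarization (I : Ideal (MvPolynomial (Fin n) k))
    (J : Ideal (PolRing k n d)) : Prop extends IsPolarization I J where
  ext_regular : ∀ i : ℕ, FormsRegularSequence (theta k n d)
    (CategoryTheory.Abelian.Ext (ModuleCat.of (PolRing k n d) (PolRing k n d ⧸ J))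
      (ModuleCat.of (PolRing k n d) (PolRing k n d)) i)

variable (k d)

/-- The standard polarization `∏_i x_{i,1} ⋯ x_{i,a_i}` of `x^a` (meaningful if all `a_i ≤ d`). -/
def pol (a : Fin n →₀ ℕ) : PolRing k n d :=
  ∏ i : Fin n, ∏ j : Fin d with j.val < a i, MvPolynomial.X (i, j)

/-- The box polarization of `x^a` (meaningful if `deg x^a ≤ d`): the product of all `x_{i,j}` with
`b_{i-1} + 1 ≤ j ≤ b_i`, where `b_i = a_1 + ⋯ + a_i`. -/
def box (a : Fin n →₀ ℕ) : PolRing k n d :=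
  ∏ i : Fin n, ∏ j : Fin d with
    (∑ l ∈ Finset.Iio i, a l) ≤ j.val ∧ j.val < ∑ l ∈ Finset.Iic i, a l, MvPolynomial.X (i, j)

/-- The mixed operator: box polarization on the variables in `A`, standard polarization on the
others. -/
def mixedBox (A : Finset (Fin n)) (a : Fin n →₀ ℕ) : PolRing k n d :=
  box k d (a.filter (· ∈ A)) * pol k d (a.filter (· ∉ A))

variable {k}

/-- The ideal generated by the images of the minimal monomial generators of `I` under the mixed
operator. -/
def mixedBoxIdeal (A : Finset (Fin n)) (I : Ideal (MvPolynomial (Fin n) k)) :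
    Ideal (PolRing k n d) :=
  Ideal.span (mixedBox k d A '' minGens I)

end Polarization

end BoxPol

end

/-! Write R for the big polynomial ring, and call a set of variables transversal if it contains at
most one `x_{i,j}` for each row `i`. Everything is deduced from a chain from `J` to the unit ideal
(`TransversalChain`): each step adjoins one monomial `f` to the current ideal `J'`, the colon ideal
`P = (J' : f)` is generated by a transversal set `F`, and `|F|` never increases along the chain.

Given such a chain, pretty cleanness holds because an inclusion of variable primes whose number of
generators does not grow is an equality. Regularity of Θ holds on each R/P, since no form of Θ has
both of its variables killed, and it passes along 0 → R/P → R/J' → R/(J'+f) → 0. For Ext,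
`Ext^i(R/P, R)` is R/P for `i = |F|` and zero otherwise, while `Ext^i(R/(J'+f), R)` vanishes for `i
> |F|`; the long exact sequence therefore breaks into short ones and the same induction applies.

To build the chain, replace the ideal by the upper set `U` of its exponent vectors, and let `r` be
such that membership in `U` depends only on the first `r` exponents. If `r > 0` is minimal, there is
a corner `u`: a monomial outside `U` in the first `r` variables that each of these variables, and
each Borel move, carries into `U` (`IsBorelSet.exists_isCorner`). Its polarization fills an interval
of columns in each row, and `P` is generated by the first free cell behind that interval in each of
the first `r` rows (`IsCorner.mul_mem_boxIdeal_iff`). Adjoining `u` to `U` preserves all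
assumptions, so `r` can only drop, and Noetherianity ends the process. -/

namespace BoxPol

universe u

/-! ### Regular sequences in short exact sequences. -/

section RegularExtension

variable {R : Type*} [CommRing R] {M₁ M₂ M₃ : Type*} [AddCommGroup M₁] [AddCommGroup M₂]
  [AddCommGroup M₃] [Module R M₁] [Module R M₂] [Module R M₃]

open RingTheory.Sequence Function

lemma isSMulRegular_of_exact {f : M₁ →ₗ[R] M₂} {g : M₂ →ₗ[R] M₃} (hf : Injective f)
    (hfg : Exact f g) {r : R} (h₁ : IsSMulRegular M₁ r) (h₃ : IsSMulRegular M₃ r) :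
    IsSMulRegular M₂ r := by
  refine isSMulRegular_iff_right_eq_zero_of_smul.mpr fun x hx => ?_
  have hgx : g x = 0 := isSMulRegular_iff_right_eq_zero_of_smul.mp h₃ _ (by
    rw [← map_smul, hx, map_zero])
  obtain ⟨y, rfl⟩ := (hfg x).mp hgx
  have : y = 0 := isSMulRegular_iff_right_eq_zero_of_smul.mp h₁ _ (hf (by
    rw [map_smul, hx, map_zero]))
  rw [this, map_zero]

/-- Weak regularity of a sequence passes to extensions. -/
lemma isWeaklyRegular_of_exact (rs : List R) {f : M₁ →ₗ[R] M₂} {g : M₂ →ₗ[R] M₃}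
    (hf : Injective f) (hfg : Exact f g) (hg : Surjective g)
    (h₁ : IsWeaklyRegular M₁ rs) (h₃ : IsWeaklyRegular M₃ rs) : IsWeaklyRegular M₂ rs := by
  induction rs generalizing M₁ M₂ M₃ with
  | nil => exact IsWeaklyRegular.nil R M₂
  | cons r rs ih =>
    rw [isWeaklyRegular_cons_iff] at h₁ h₃ ⊢
    refine ⟨isSMulRegular_of_exact hf hfg h₁.1 h₃.1, ?_⟩
    refine ih (f := QuotSMulTop.map r f) (g := QuotSMulTop.map r g) ?_
      (QuotSMulTop.map_exact r hfg hg) (QuotSMulTop.map_surjective r hg) h₁.2 h₃.2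
    -- Regularity of `r` on `M₃` makes `M₁/r → M₂/r` injective; the four-term statement yields this
    -- with the zero map on the left.
    have h₀ : Exact (0 : M₁ →ₗ[R] M₁) f := fun x => by
      rw [map_eq_zero_iff f hf]
      simp [eq_comm]
    have := QuotSMulTop.map_first_exact_on_four_term_exact_of_isSMulRegular_last h₀ hfg h₃.1
    rw [injective_iff_map_eq_zero]
    intro x hx
    obtain ⟨y, rfl⟩ := (this x).mp hx
    simp

lemma FormsRegularSequence.of_linearEquiv {T : Set R} (e : M₁ ≃ₗ[R] M₂)
    (h : FormsRegularSequence T M₁) : FormsRegularSequence T M₂ := by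
  refine ⟨h.1, fun l hl hT => ?_⟩
  rcases h.2 l hl hT with h | h
  · exact Or.inl e.symm.injective.subsingleton
  · exact Or.inr ((e.isRegular_congr l).mp h)

lemma FormsRegularSequence.of_subsingleton {T : Set R} (hT : T.Finite) [Subsingleton M₁] :
    FormsRegularSequence T M₁ :=
  ⟨hT, fun _ _ _ => Or.inl inferInstance⟩

/-- Forming a regular sequence passes to extensions. -/
lemma FormsRegularSequence.of_exact {T : Set R} {f : M₁ →ₗ[R] M₂} {g : M₂ →ₗ[R] M₃}
    (hf : Injective f) (hfg : Exact f g) (hg : Surjective g)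
    (h₁ : FormsRegularSequence T M₁) (h₃ : FormsRegularSequence T M₃) :
    FormsRegularSequence T M₂ := by
  refine ⟨h₁.1, fun l hl hT => ?_⟩
  -- If `M₃` is zero, `f` is an isomorphism. Otherwise properness of `Θ M₂` is inherited from the
  -- quotient `M₃`, even if `M₁` is zero.
  rcases h₃.2 l hl hT with h | h
  · have hs : Surjective f := fun x => (hfg x).mp (Subsingleton.elim _ _)
    exact (h₁.of_linearEquiv (LinearEquiv.ofBijective f ⟨hf, hs⟩)).2 l hl hT
  · right
    have hw : IsWeaklyRegular M₂ l := by
      refine isWeaklyRegular_of_exact l hf hfg hg ?_ h.toIsWeaklyRegular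
      rcases h₁.2 l hl hT with h' | h'
      · exact ⟨fun i hi => fun x y _ => Subsingleton.elim _ _⟩
      · exact h'.toIsWeaklyRegular
    refine ⟨hw, fun htop => h.top_ne_smul ?_⟩
    have := congrArg (Submodule.map g) htop
    rwa [Submodule.map_smul'', Submodule.map_top, LinearMap.range_eq_top.mpr hg] at this

end RegularExtension

/-! ### The exact sequence of a colon ideal. -/

section ColonSequence

variable {R : Type u} [CommRing R] {J P : Ideal R} {f : R}

/-- Multiplication by `f` as a map `R ⧸ P → R ⧸ J`, for `P = (J : f)`. -/
noncomputable def mulQuot (J P : Ideal R) (f : R) (h : ∀ g, g * f ∈ J ↔ g ∈ P) :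
    (R ⧸ P) →ₗ[R] (R ⧸ J) :=
  Submodule.mapQ P J (LinearMap.toSpanSingleton R R f) fun g hg => (h g).mpr hg

lemma mulQuot_mk (h : ∀ g, g * f ∈ J ↔ g ∈ P) (g : R) :
    mulQuot J P f h (Submodule.Quotient.mk g) = Submodule.Quotient.mk (g * f) := rfl

lemma mulQuot_injective (h : ∀ g, g * f ∈ J ↔ g ∈ P) :
    Function.Injective (mulQuot J P f h) := by
  rw [injective_iff_map_eq_zero]
  intro x
  obtain ⟨g, rfl⟩ := Submodule.Quotient.mk_surjective _ x
  rw [mulQuot_mk, Submodule.Quotient.mk_eq_zero, Submodule.Quotient.mk_eq_zero]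
  exact (h g).mp

/-- The projection `R ⧸ J → R ⧸ (J + (f))`. -/
noncomputable def projQuot (J : Ideal R) (f : R) : (R ⧸ J) →ₗ[R] (R ⧸ (J ⊔ Ideal.span {f})) :=
  Submodule.mapQ J _ LinearMap.id le_sup_left

lemma projQuot_mk (g : R) : projQuot J f (Submodule.Quotient.mk g) = Submodule.Quotient.mk g := rfl

lemma projQuot_surjective : Function.Surjective (projQuot J f) := by
  intro x
  obtain ⟨g, rfl⟩ := Submodule.Quotient.mk_surjective _ x
  exact ⟨Submodule.Quotient.mk g, rfl⟩

lemma mulQuot_exact_projQuot (h : ∀ g, g * f ∈ J ↔ g ∈ P) :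
    Function.Exact (mulQuot J P f h) (projQuot J f) := by
  intro x
  obtain ⟨g, rfl⟩ := Submodule.Quotient.mk_surjective _ x
  rw [projQuot_mk, Submodule.Quotient.mk_eq_zero, Submodule.mem_sup]
  constructor
  · rintro ⟨a, ha, b, hb, rfl⟩
    obtain ⟨c, rfl⟩ := Ideal.mem_span_singleton'.mp hb
    refine ⟨Submodule.Quotient.mk c, ?_⟩
    rw [mulQuot_mk, Submodule.Quotient.eq]
    simpa using ha
  · rintro ⟨y, hy⟩
    obtain ⟨c, rfl⟩ := Submodule.Quotient.mk_surjective _ y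
    rw [mulQuot_mk, Submodule.Quotient.eq] at hy
    refine ⟨g - c * f, ?_, c * f, Ideal.mem_span_singleton'.mpr ⟨c, rfl⟩, by ring⟩
    simpa using J.neg_mem hy

end ColonSequence

/-! ### The long exact Ext sequence and concentration in one degree. -/

section ExtModules

open CategoryTheory CategoryTheory.Abelian

variable {R : Type u} [CommRing R]

/-- `Ext^i(R/J, R)`. -/
abbrev ExtQuot (J : Ideal R) (i : ℕ) : Type u :=
  Ext (ModuleCat.of R (R ⧸ J)) (ModuleCat.of R R) i

variable {J P : Ideal R} {f : R}

/-- The sequence `R/P → R/J → R/(J + (f))` for `P = (J : f)`. -/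
noncomputable abbrev colonComplex (h : ∀ g, g * f ∈ J ↔ g ∈ P) : ShortComplex (ModuleCat.{u} R) :=
  ShortComplex.mk (ModuleCat.ofHom (mulQuot J P f h)) (ModuleCat.ofHom (projQuot J f)) (by
    rw [← ModuleCat.ofHom_comp, (mulQuot_exact_projQuot h).linearMap_comp_eq_zero]
    rfl)

lemma colonComplex_shortExact (h : ∀ g, g * f ∈ J ↔ g ∈ P) : (colonComplex h).ShortExact := by
  have := (ModuleCat.mono_iff_injective (colonComplex h).f).mpr (mulQuot_injective h)
  have := (ModuleCat.epi_iff_surjective (colonComplex h).g).mpr projQuot_surjective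
  refine ShortComplex.ShortExact.mk ?_
  rw [ShortComplex.ShortExact.moduleCat_exact_iff_function_exact]
  exact mulQuot_exact_projQuot h

/-- Restriction along `R/P → R/J`. -/
noncomputable abbrev extRes (h : ∀ g, g * f ∈ J ↔ g ∈ P) (i : ℕ) :
    ExtQuot J i →ₗ[R] ExtQuot P i :=
  (Ext.mk₀ (colonComplex h).f).precompOfLinear R (ModuleCat.of R R) (zero_add i)

/-- Inflation along `R/J → R/(J + (f))`. -/
noncomputable abbrev extInf (h : ∀ g, g * f ∈ J ↔ g ∈ P) (i : ℕ) :
    ExtQuot (J ⊔ Ideal.span {f}) i →ₗ[R] ExtQuot J i :=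
  (Ext.mk₀ (colonComplex h).g).precompOfLinear R (ModuleCat.of R R) (zero_add i)

/-- The connecting map. -/
noncomputable abbrev extConn (h : ∀ g, g * f ∈ J ↔ g ∈ P) {i j : ℕ} (hij : 1 + i = j) :
    ExtQuot P i →ₗ[R] ExtQuot (J ⊔ Ideal.span {f}) j :=
  (colonComplex_shortExact h).extClass.precompOfLinear R (ModuleCat.of R R) hij

lemma exact_extInf_extRes (h : ∀ g, g * f ∈ J ↔ g ∈ P) (i : ℕ) :
    Function.Exact (extInf h i) (extRes h i) := by
  intro x
  refine ⟨fun hx => Ext.contravariant_sequence_exact₂ (colonComplex_shortExact h) _ x hx, ?_⟩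
  rintro ⟨y, rfl⟩
  exact (Ext.mk₀_comp_mk₀_assoc _ _ _).trans (by
    rw [(colonComplex h).zero, Ext.mk₀_zero, Ext.zero_comp])

lemma exact_extRes_extConn (h : ∀ g, g * f ∈ J ↔ g ∈ P) {i j : ℕ} (hij : 1 + i = j) :
    Function.Exact (extRes h i) (extConn h hij) := by
  intro x
  refine ⟨fun hx => Ext.contravariant_sequence_exact₁ (colonComplex_shortExact h) _ x hij hx, ?_⟩
  rintro ⟨y, rfl⟩
  exact ShortComplex.ShortExact.extClass_comp_assoc _ _ (h := hij)

lemma exact_extConn_extInf (h : ∀ g, g * f ∈ J ↔ g ∈ P) {i j : ℕ} (hij : 1 + i = j) :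
    Function.Exact (extConn h hij) (extInf h j) := by
  intro x
  refine ⟨fun hx => Ext.contravariant_sequence_exact₃ (colonComplex_shortExact h) _ x hx hij, ?_⟩
  rintro ⟨y, rfl⟩
  exact ShortComplex.ShortExact.comp_extClass_assoc _ _ hij

lemma extInf_zero_injective (h : ∀ g, g * f ∈ J ↔ g ∈ P) : Function.Injective (extInf h 0) := by
  have := (ModuleCat.epi_iff_surjective (colonComplex h).g).mpr projQuot_surjective
  exact Ext.precomp_mk₀_injective_of_epi _ (colonComplex h).g

/-- Inflation is injective if the preceding `Ext` module is trivial. -/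
lemma extInf_injective (h : ∀ g, g * f ∈ J ↔ g ∈ P) {j : ℕ}
    (hj : ∀ i, 1 + i = j → Subsingleton (ExtQuot P i)) : Function.Injective (extInf h j) := by
  rcases Nat.eq_zero_or_pos j with rfl | hpos
  · exact extInf_zero_injective h
  · have hij : 1 + (j - 1) = j := by omega
    have := hj _ hij
    rw [injective_iff_map_eq_zero]
    intro x hx
    obtain ⟨y, rfl⟩ := (exact_extConn_extInf h hij x).mp hx
    rw [Subsingleton.elim y 0, map_zero]

/-- `Ext^i(R/P, R)` vanishes for `i ≠ c` and is isomorphic to `R/P` for `i = c`. -/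
def ExtConcentrated (P : Ideal R) (c : ℕ) : Prop :=
  (∀ i, i ≠ c → Subsingleton (ExtQuot P i)) ∧
    ∃ ψ : R →ₗ[R] ExtQuot P c, Function.Surjective ψ ∧ LinearMap.ker ψ = P

lemma ExtConcentrated.nonempty_linearEquiv {c : ℕ} (h : ExtConcentrated P c) :
    Nonempty ((R ⧸ P) ≃ₗ[R] ExtQuot P c) := by
  obtain ⟨-, ψ, hψ, hker⟩ := h
  exact ⟨(Submodule.quotEquivOfEq _ _ hker.symm).trans (ψ.quotKerEquivOfSurjective hψ)⟩

lemma extConcentrated_bot : ExtConcentrated (⊥ : Ideal R) 0 := by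
  have e : R ≃ₗ[R] (R ⧸ (⊥ : Ideal R)) := (Submodule.quotEquivOfEqBot ⊥ rfl).symm
  have : Module.Projective R (R ⧸ (⊥ : Ideal R)) := Module.Projective.of_equiv e
  have : Projective (ModuleCat.of R (R ⧸ (⊥ : Ideal R))) :=
    ModuleCat.projective_of_categoryTheory_projective _
  refine ⟨fun i hi => ?_, ?_⟩
  · obtain ⟨i, rfl⟩ := Nat.exists_eq_succ_of_ne_zero hi
    exact Ext.subsingleton_of_projective _ _ _
  · let E : R ≃ₗ[R] ExtQuot (⊥ : Ideal R) 0 :=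
      ((LinearMap.ringLmapEquivSelf R R R).symm.trans
        (e.symm.arrowCongr (LinearEquiv.refl R R)).symm).trans
        (ModuleCat.homLinearEquiv (M := ModuleCat.of R (R ⧸ (⊥ : Ideal R)))
          (N := ModuleCat.of R R) (S := R)).symm |>.trans Ext.linearEquiv₀.symm
    exact ⟨E.toLinearMap, E.surjective, E.ker⟩

/-- If `f` is a nonzerodivisor on `R/P`, then adding `f` raises the degree in which the `Ext`
modules are concentrated by one. -/
lemma ExtConcentrated.sup_span_singleton {c : ℕ} (hP : ExtConcentrated P c)
    (h : ∀ g, g * f ∈ P ↔ g ∈ P) : ExtConcentrated (P ⊔ Ideal.span {f}) (c + 1) := by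
  obtain ⟨hvan, ψ, hψ, hker⟩ := hP
  -- With `J = P`, the first map of the complex is multiplication by `f`, so it acts on Ext as `f`.
  have hres : ∀ i (x : ExtQuot P i), extRes h i x = f • x := by
    intro i x
    have : (colonComplex h).f = f • 𝟙 (ModuleCat.of R (R ⧸ P)) := by
      refine ModuleCat.hom_ext (LinearMap.ext fun y => ?_)
      obtain ⟨g, rfl⟩ := Submodule.Quotient.mk_surjective _ y
      change Submodule.Quotient.mk (g * f) = f • (Submodule.Quotient.mk g : R ⧸ P)
      rw [← Submodule.Quotient.mk_smul, smul_eq_mul, mul_comm]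
    change (Ext.mk₀ (colonComplex h).f).comp x (zero_add i) = _
    rw [this, Ext.mk₀_smul, Ext.smul_comp, Ext.mk₀_id_comp]
  have hreg : ∀ i (x : ExtQuot P i), f • x = 0 → x = 0 := by
    intro i x hx
    by_cases hi : i = c
    · subst hi
      obtain ⟨g, rfl⟩ := hψ x
      rw [← map_smul, ← LinearMap.mem_ker, hker, smul_eq_mul, mul_comm, h] at hx
      rwa [← LinearMap.mem_ker, hker]
    · have := hvan i hi
      exact Subsingleton.elim _ _
  refine ⟨fun i hi => ?_, ?_⟩
  · have hinj : Function.Injective (extInf h i) :=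
      extInf_injective h fun j hj => hvan j (by omega)
    refine subsingleton_of_forall_eq 0 fun x => hinj ?_
    rw [map_zero]
    apply hreg
    rw [← hres]
    exact (exact_extInf_extRes h i).apply_apply_eq_zero x
  · refine ⟨extConn h (add_comm 1 c) ∘ₗ ψ, ?_, ?_⟩
    · rw [LinearMap.coe_comp]
      refine Function.Surjective.comp (fun x => ?_) hψ
      have := hvan (c + 1) (by omega)
      exact (exact_extConn_extInf h (add_comm 1 c) x).mp (Subsingleton.elim _ _)
    · ext g
      rw [LinearMap.mem_ker, LinearMap.comp_apply, exact_extRes_extConn h (add_comm 1 c) (ψ g),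
        Submodule.mem_sup]
      constructor
      · rintro ⟨y, hy⟩
        obtain ⟨b, rfl⟩ := hψ y
        rw [hres, ← map_smul, ← sub_eq_zero, ← map_sub, ← LinearMap.mem_ker, hker] at hy
        refine ⟨g - f • b, ?_, f • b, ?_, by ring⟩
        · simpa using P.neg_mem hy
        · exact Ideal.mem_span_singleton'.mpr ⟨b, mul_comm _ _⟩
      · rintro ⟨a, ha, b, hb, rfl⟩
        obtain ⟨b, rfl⟩ := Ideal.mem_span_singleton'.mp hb
        refine ⟨ψ b, ?_⟩
        rw [← hker, LinearMap.mem_ker] at ha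
        rw [hres, map_add, ha, zero_add, ← map_smul, smul_eq_mul, mul_comm]

end ExtModules

/-! ### Primes generated by variables. -/

section VariableIdeals

open MvPolynomial

variable {k : Type u} [Field k] {σ : Type}

/-- An ideal modulo which every variable is congruent to its image under a substitution killing
the ideal is the kernel of that substitution. -/
lemma mem_iff_aeval_eq_zero {Q : Ideal (MvPolynomial σ k)} {w : σ → MvPolynomial σ k}
    (hw : ∀ v, X v - w v ∈ Q) (hQ : ∀ f ∈ Q, aeval w f = 0) (f : MvPolynomial σ k) :
    f ∈ Q ↔ aeval w f = 0 := by
  refine ⟨hQ f, fun hf => ?_⟩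
  have key : (Ideal.Quotient.mkₐ k Q).comp (aeval w) = Ideal.Quotient.mkₐ k Q := by
    refine MvPolynomial.algHom_ext fun v => ?_
    rw [AlgHom.comp_apply, aeval_X, eq_comm]
    exact Ideal.Quotient.eq.mpr (hw v)
  have := DFunLike.congr_fun key f
  rw [AlgHom.comp_apply, hf, map_zero] at this
  exact Ideal.Quotient.eq_zero_iff_mem.mp this.symm

/-- The prime ideal generated by a set of variables. -/
noncomputable def varIdeal (k : Type u) [Field k] (F : Finset σ) : Ideal (MvPolynomial σ k) :=
  Ideal.span (X '' (F : Set σ))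

variable {F : Finset σ}

lemma X_mem_varIdeal {v : σ} (hv : v ∈ F) : X v ∈ varIdeal k F :=
  Ideal.subset_span ⟨v, hv, rfl⟩

lemma mem_varIdeal_iff [DecidableEq σ] (f : MvPolynomial σ k) :
    f ∈ varIdeal k F ↔ aeval (fun v => if v ∈ F then 0 else (X v : MvPolynomial σ k)) f = 0 := by
  refine mem_iff_aeval_eq_zero (fun v => ?_) (fun f hf => ?_) f
  · split_ifs with h
    · simpa using X_mem_varIdeal h
    · simp
  · rw [← RingHom.mem_ker]
    refine (Ideal.span_le (I := RingHom.ker _)).mpr ?_ hf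
    rintro _ ⟨v, hv, rfl⟩
    simpa using hv

lemma isPrime_varIdeal : (varIdeal k F).IsPrime := by
  classical
  have : varIdeal k F =
      RingHom.ker (aeval (R := k) fun v => if v ∈ F then 0 else (X v : MvPolynomial σ k)) := by
    ext f
    rw [mem_varIdeal_iff, RingHom.mem_ker]
  rw [this]
  exact RingHom.ker_isPrime _

lemma prod_X_mem_varIdeal_iff {B : Finset σ} :
    ∏ v ∈ B, X v ∈ varIdeal k F ↔ ∃ v ∈ B, v ∈ F := by
  classical
  rw [mem_varIdeal_iff, map_prod, Finset.prod_eq_zero_iff]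
  simp

lemma X_mem_varIdeal_iff {v : σ} : X v ∈ varIdeal k F ↔ v ∈ F := by
  simpa using prod_X_mem_varIdeal_iff (k := k) (F := F) (B := {v})

lemma varIdeal_le_iff {G : Finset σ} : varIdeal k F ≤ varIdeal k G ↔ F ⊆ G := by
  refine ⟨fun h v hv => X_mem_varIdeal_iff.mp (h (X_mem_varIdeal hv)), fun h => ?_⟩
  exact Ideal.span_mono (Set.image_mono (Finset.coe_subset.mpr h))

lemma varIdeal_insert [DecidableEq σ] (v : σ) :
    varIdeal k (insert v F) = varIdeal k F ⊔ Ideal.span {X v} := by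
  rw [varIdeal, Finset.coe_insert, Set.image_insert_eq, Ideal.span_insert, sup_comm]
  rfl

/-- Variables form a regular sequence: each new one is a nonzerodivisor modulo the prime generated
by the earlier ones, so the degree rises by one each time. -/
lemma extConcentrated_varIdeal (F : Finset σ) : ExtConcentrated (varIdeal k F) F.card := by
  classical
  induction F using Finset.induction_on with
  | empty =>
    have : varIdeal k (∅ : Finset σ) = ⊥ := by simp [varIdeal]
    rw [this]
    exact extConcentrated_bot
  | insert v F hv ih =>
    rw [varIdeal_insert, Finset.card_insert_of_notMem hv]
    refine ih.sup_span_singleton fun g => ⟨fun h => ?_, fun h => Ideal.mul_mem_right _ _ h⟩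
    exact (isPrime_varIdeal.mem_or_mem h).resolve_right fun h => hv (X_mem_varIdeal_iff.mp h)

end VariableIdeals

/-! ### Regularity of Θ modulo a transversal set of variables. -/

section Theta

open MvPolynomial RingTheory.Sequence

lemma mk_mem_smul_top_iff {R : Type*} [CommRing R] {K P : Ideal R} {f : R} :
    (Submodule.Quotient.mk f : R ⧸ P) ∈ (K • ⊤ : Submodule R (R ⧸ P)) ↔ f ∈ P ⊔ K := by
  have : (K • ⊤ : Submodule R (R ⧸ P)) = Submodule.map P.mkQ K := by
    rw [← Submodule.range_mkQ P, LinearMap.range_eq_map, ← Submodule.map_smul'']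
    simp
  rw [this, ← Submodule.comap_map_mkQ P K]
  rfl

variable {k : Type u} [Field k] {n d : ℕ}

lemma finite_theta : (theta k n d).Finite := by
  refine (Set.finite_range fun p : Fin n × Fin d × Fin d =>
    (X (p.1, p.2.1) - X (p.1, p.2.2) : PolRing k n d)).subset ?_
  rintro _ ⟨i, j₁, j, -, -, rfl⟩
  exact ⟨(i, j₁, j), rfl⟩

/-- A set of variables containing at most one variable of each row. -/
def IsTransversal (F : Finset (Fin n × Fin d)) : Prop :=
  ∀ v ∈ F, ∀ w ∈ F, v.1 = w.1 → v = w

/-- A linear form of `Θ` is a nonzerodivisor modulo a transversal set of variables and other forms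
of `Θ`. -/
lemma IsTransversal.mem_of_theta_mul_mem {F : Finset (Fin n × Fin d)} (hF : IsTransversal F)
    {T : Set (PolRing k n d)} (hT : T ⊆ theta k n d) {t : PolRing k n d} (ht : t ∈ theta k n d)
    (htT : t ∉ T) {f : PolRing k n d} (hf : t * f ∈ varIdeal k F ⊔ Ideal.span T) :
    f ∈ varIdeal k F ⊔ Ideal.span T := by
  classical
  obtain ⟨i, z, j, hz, hj, rfl⟩ := ht
  set Q := varIdeal k F ⊔ Ideal.span T with hQ
  -- The forms in `T` glue variables to the first variable of their row; `rep` picks a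
  -- representative of each class and `w` kills the classes meeting `F`. Then `Q` is the kernel of
  -- `aeval w`, a map into a domain.
  let rep : Fin n × Fin d → Fin n × Fin d := fun v =>
    if 0 < v.2.val ∧ (X (v.1, z) - X v : PolRing k n d) ∈ T then (v.1, z) else v
  have rep_fst : ∀ v, (rep v).1 = v.1 := fun v => by simp only [rep]; split_ifs <;> rfl
  have rep_z : ∀ a, rep (a, z) = (a, z) := fun a => by simp only [rep]; split_ifs <;> rfl
  have rep_j : rep (i, j) = (i, j) := if_neg fun h => htT h.2
  let w : Fin n × Fin d → PolRing k n d := fun v =>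
    if ∃ v' ∈ F, rep v' = rep v then 0 else X (rep v)
  have hrep : ∀ v, (X v - X (rep v) : PolRing k n d) ∈ Q := by
    intro v
    by_cases h : 0 < v.2.val ∧ (X (v.1, z) - X v : PolRing k n d) ∈ T
    · have : rep v = (v.1, z) := if_pos h
      rw [this, ← neg_sub]
      exact Q.neg_mem (Ideal.mem_sup_right (Ideal.subset_span h.2))
    · have : rep v = v := if_neg h
      rw [this, sub_self]
      exact Q.zero_mem
  have hw : ∀ v, X v - w v ∈ Q := by
    intro v
    by_cases h : ∃ v' ∈ F, rep v' = rep v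
    · have e : w v = 0 := if_pos h
      obtain ⟨v', hv', hvv⟩ := h
      have h₁ : (X v' : PolRing k n d) ∈ Q := Ideal.mem_sup_left (X_mem_varIdeal hv')
      have h₂ := hrep v'
      rw [hvv] at h₂
      rw [e]
      convert Q.add_mem (Q.sub_mem h₁ h₂) (hrep v) using 1
      ring
    · have e : w v = X (rep v) := if_neg h
      rw [e]
      exact hrep v
  have hker : ∀ f ∈ Q, aeval w f = 0 := by
    intro f hf
    rw [← RingHom.mem_ker]
    refine (sup_le ?_ ?_ : Q ≤ RingHom.ker _) hf
    · refine Ideal.span_le.mpr ?_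
      rintro _ ⟨v, hv, rfl⟩
      simp only [SetLike.mem_coe, RingHom.mem_ker, aeval_X]
      exact if_pos ⟨v, hv, rfl⟩
    · refine Ideal.span_le.mpr fun t ht => ?_
      obtain ⟨a, z', b, hz', hb, rfl⟩ := hT ht
      obtain rfl : z' = z := Fin.ext (hz'.trans hz.symm)
      have hr : rep (a, b) = (a, z') := if_pos ⟨hb, ht⟩
      simp only [SetLike.mem_coe, RingHom.mem_ker, map_sub, aeval_X, w, hr, rep_z, sub_self]
  rw [mem_iff_aeval_eq_zero hw hker] at hf ⊢
  rw [map_mul] at hf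
  refine (mul_eq_zero.mp hf).resolve_left ?_
  have hne : ((i, z) : Fin n × Fin d) ≠ (i, j) := fun h => by
    have := congrArg (fun v : Fin n × Fin d => v.2.val) h
    simp only at this
    omega
  -- Gluing stays inside rows, so by transversality two distinct classes of row `i` cannot both be
  -- killed; hence the image of the form is nonzero.
  have hdead : ¬((∃ v' ∈ F, rep v' = (i, z)) ∧ ∃ v' ∈ F, rep v' = (i, j)) := by
    rintro ⟨⟨v, hv, hvr⟩, ⟨v', hv', hvr'⟩⟩
    have : v = v' := hF v hv v' hv' (by rw [← rep_fst v, ← rep_fst v', hvr, hvr'])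
    subst this
    exact hne (hvr.symm.trans hvr')
  simp only [map_sub, aeval_X, w, rep_z, rep_j]
  split_ifs with h₁ h₂ h₂
  · exact absurd ⟨h₁, h₂⟩ hdead
  · simp
  · simp
  · exact sub_ne_zero.mpr fun h => hne (X_injective h)

lemma IsTransversal.formsRegularSequence {F : Finset (Fin n × Fin d)} (hF : IsTransversal F) :
    FormsRegularSequence (theta k n d) (PolRing k n d ⧸ varIdeal k F) := by
  refine ⟨finite_theta, fun l hl hT => Or.inr ⟨⟨fun i hi => ?_⟩, fun htop => ?_⟩⟩
  · rw [isSMulRegular_quotient_iff_mem_of_smul_mem]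
    intro x
    obtain ⟨f, rfl⟩ := Submodule.Quotient.mk_surjective _ x
    rw [← Submodule.Quotient.mk_smul, mk_mem_smul_top_iff, mk_mem_smul_top_iff]
    refine hF.mem_of_theta_mul_mem (fun r hr => (hT r).mp (List.mem_of_mem_take hr))
      ((hT _).mp (List.getElem_mem hi)) ?_
    intro h
    obtain ⟨j, hj, hji⟩ := List.mem_take_iff_getElem.mp h
    have := (List.Nodup.getElem_inj_iff hl).mp hji
    omega
  · have h : (Submodule.Quotient.mk 1 : PolRing k n d ⧸ varIdeal k F) ∈
        (Ideal.ofList l • ⊤ : Submodule (PolRing k n d) (PolRing k n d ⧸ varIdeal k F)) :=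
      htop ▸ Submodule.mem_top
    rw [mk_mem_smul_top_iff] at h
    -- All generators have constant term zero, so 1 is not among their combinations.
    have hle : varIdeal k F ⊔ Ideal.ofList l ≤
        RingHom.ker (constantCoeff (R := k) (σ := Fin n × Fin d)) := by
      refine sup_le (Ideal.span_le.mpr ?_) (Ideal.span_le.mpr fun r hr => ?_)
      · rintro _ ⟨v, -, rfl⟩
        simp
      · obtain ⟨i, j₁, j, -, -, rfl⟩ := (hT r).mp hr
        simp
    have := hle h
    rw [RingHom.mem_ker, map_one] at this
    exact one_ne_zero this

end Theta

/-! ### Cyclic factors of a filtration. -/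

section PrimeFactor

variable {R M : Type*} [CommRing R] [AddCommGroup M] [Module R M]

lemma nonempty_quotient_sup_span_equiv {N : Submodule R M} {x : M} {P : Ideal R}
    (h : ∀ g : R, g • x ∈ N ↔ g ∈ P) :
    Nonempty ((↥(N ⊔ Submodule.span R {x}) ⧸ N.submoduleOf (N ⊔ Submodule.span R {x})) ≃ₗ[R]
      (R ⧸ P)) := by
  set N' := N ⊔ Submodule.span R {x} with hN'
  have hx : x ∈ N' := Submodule.mem_sup_right (Submodule.mem_span_singleton_self x)
  let ψ : R →ₗ[R] (N' ⧸ N.submoduleOf N') :=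
    (N.submoduleOf N').mkQ ∘ₗ LinearMap.toSpanSingleton R N' ⟨x, hx⟩
  have hker : LinearMap.ker ψ = P := by
    ext g
    rw [← h, LinearMap.mem_ker, LinearMap.comp_apply, Submodule.mkQ_apply,
      Submodule.Quotient.mk_eq_zero]
    rfl
  have hsurj : Function.Surjective ψ := by
    intro y
    obtain ⟨⟨y, hy⟩, rfl⟩ := Submodule.Quotient.mk_surjective _ y
    obtain ⟨a, ha, b, hb, rfl⟩ := Submodule.mem_sup.mp hy
    obtain ⟨c, rfl⟩ := Submodule.mem_span_singleton.mp hb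
    refine ⟨c, ?_⟩
    rw [LinearMap.comp_apply, Submodule.mkQ_apply, Submodule.Quotient.eq]
    change c • x - (a + c • x) ∈ N
    simpa using ha
  exact ⟨((Submodule.quotEquivOfEq _ _ hker.symm).trans
    (ψ.quotKerEquivOfSurjective hsurj)).symm⟩

end PrimeFactor

/-! ### Consequences of a transversal chain. -/

section Chains

variable {k : Type u} [Field k] {n d : ℕ}

/-- There is a chain from `J` to the unit ideal, each step adjoining one element, whose successive
quotients are the quotients by transversal sets of variables, of non-increasing cardinalities
bounded by `r`. -/
inductive TransversalChain : ℕ → Ideal (PolRing k n d) → Prop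
  | top (r : ℕ) : TransversalChain r ⊤
  | step {r : ℕ} {J : Ideal (PolRing k n d)} {f : PolRing k n d} {F : Finset (Fin n × Fin d)}
      (hF : IsTransversal F) (hr : F.card ≤ r) (hcolon : ∀ g, g * f ∈ J ↔ g ∈ varIdeal k F)
      (h : TransversalChain F.card (J ⊔ Ideal.span {f})) : TransversalChain r J

lemma TransversalChain.mono {r s : ℕ} {J : Ideal (PolRing k n d)} (h : TransversalChain r J)
    (hrs : r ≤ s) : TransversalChain s J := by
  cases h with
  | top => exact .top s
  | step hF hr hcolon h => exact .step hF (hr.trans hrs) hcolon h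

lemma TransversalChain.formsRegularSequence {r : ℕ} {J : Ideal (PolRing k n d)}
    (h : TransversalChain r J) : FormsRegularSequence (theta k n d) (PolRing k n d ⧸ J) := by
  induction h with
  | top r =>
    have : Subsingleton (PolRing k n d ⧸ (⊤ : Ideal (PolRing k n d))) :=
      Ideal.Quotient.subsingleton_iff.mpr rfl
    exact .of_subsingleton finite_theta
  | step hF hr hcolon h ih =>
    exact hF.formsRegularSequence.of_exact (mulQuot_injective hcolon)
      (mulQuot_exact_projQuot hcolon) projQuot_surjective ih

lemma subsingleton_extQuot_top {R : Type u} [CommRing R] (i : ℕ) :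
    Subsingleton (ExtQuot (⊤ : Ideal R) i) := by
  have : Subsingleton (R ⧸ (⊤ : Ideal R)) := Ideal.Quotient.subsingleton_iff.mpr rfl
  have h0 := ModuleCat.isZero_of_subsingleton (ModuleCat.of R (R ⧸ (⊤ : Ideal R)))
  refine subsingleton_of_forall_eq 0 fun x => ?_
  rw [← CategoryTheory.Abelian.Ext.mk₀_id_comp x,
    h0.eq_of_src (CategoryTheory.CategoryStruct.id _) 0,
    CategoryTheory.Abelian.Ext.mk₀_zero, CategoryTheory.Abelian.Ext.zero_comp]

/-- Every factor of the chain has its only Ext in degree `|F| ≤ r`, and vanishing passes to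
extensions. -/
lemma TransversalChain.subsingleton_ext {r : ℕ} {J : Ideal (PolRing k n d)}
    (h : TransversalChain r J) {i : ℕ} (hi : r < i) : Subsingleton (ExtQuot J i) := by
  induction h with
  | top r => exact subsingleton_extQuot_top i
  | @step r J f F hF hr hcolon h ih =>
    have h₁ := ih (lt_of_le_of_lt hr hi)
    have h₂ := (extConcentrated_varIdeal (k := k) F).1 i (by omega)
    refine subsingleton_of_forall_eq 0 fun x => ?_
    obtain ⟨y, rfl⟩ := (exact_extInf_extRes hcolon i x).mp (Subsingleton.elim _ _)
    rw [Subsingleton.elim y 0, map_zero]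

lemma IsTransversal.formsRegularSequence_ext {F : Finset (Fin n × Fin d)} (hF : IsTransversal F)
    (i : ℕ) : FormsRegularSequence (theta k n d) (ExtQuot (varIdeal k F) i) := by
  by_cases hi : i = F.card
  · subst hi
    exact hF.formsRegularSequence.of_linearEquiv
      (extConcentrated_varIdeal F).nonempty_linearEquiv.some
  · have := (extConcentrated_varIdeal (k := k) F).1 i hi
    exact .of_subsingleton finite_theta

/-- The connecting map out of `Ext^i(R/P, R)` is zero for every `i`: its source vanishes unless `i =
|F|`, and in that case its target, in degree `|F| + 1`, vanishes by the bound on the rest of the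
chain. Hence inflation and restriction form a short exact sequence. -/
lemma TransversalChain.formsRegularSequence_ext {r : ℕ} {J : Ideal (PolRing k n d)}
    (h : TransversalChain r J) (i : ℕ) :
    FormsRegularSequence (theta k n d) (ExtQuot J i) := by
  induction h with
  | top r =>
    have := subsingleton_extQuot_top (R := PolRing k n d) i
    exact .of_subsingleton finite_theta
  | @step r J f F hF hr hcolon h ih =>
    have hvan := (extConcentrated_varIdeal (k := k) F).1
    refine ih.of_exact (f := extInf hcolon i) (g := extRes hcolon i) ?_
      (exact_extInf_extRes hcolon i) ?_ (hF.formsRegularSequence_ext i)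
    · by_cases hi : i = F.card + 1
      · have := h.subsingleton_ext (i := i) (by omega)
        exact Function.injective_of_subsingleton _
      · exact extInf_injective hcolon fun j hj => hvan j (by omega)
    · intro x
      refine (exact_extRes_extConn hcolon (add_comm 1 i) x).mp ?_
      by_cases hi : i = F.card
      · have := h.subsingleton_ext (i := i + 1) (by omega)
        exact Subsingleton.elim _ _
      · have := hvan i hi
        rw [Subsingleton.elim x 0, map_zero]

/-- Unrolls the inductive predicate into indexed families, the form required for a filtration;
`casesOn` prepends the new step. -/
lemma TransversalChain.exists_sequence {r : ℕ} {J : Ideal (PolRing k n d)}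
    (h : TransversalChain r J) :
    ∃ (t : ℕ) (K : ℕ → Ideal (PolRing k n d)) (f : ℕ → PolRing k n d)
      (F : ℕ → Finset (Fin n × Fin d)), K 0 = J ∧ K t = ⊤ ∧ (∀ i < t, (F i).card ≤ r) ∧
      (∀ i < t, K (i + 1) = K i ⊔ Ideal.span {f i}) ∧
      (∀ i < t, ∀ g, g * f i ∈ K i ↔ g ∈ varIdeal k (F i)) ∧
      ∀ i j, i < j → j < t → (F j).card ≤ (F i).card := by
  induction h with
  | top r => exact ⟨0, fun _ => ⊤, fun _ => 0, fun _ => ∅, rfl, rfl, by simp⟩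
  | @step r J f F hF hr hcolon h ih =>
    obtain ⟨t, K, f', F', h0, ht, hcard, hstep, hcol, hmono⟩ := ih
    refine ⟨t + 1, fun i => i.casesOn J K, fun i => i.casesOn f f', fun i => i.casesOn F F',
      rfl, ht, ?_, ?_, ?_, ?_⟩
    · rintro (_ | i) hi
      · exact hr
      · exact (hcard i (by omega)).trans hr
    · rintro (_ | i) hi
      · exact h0
      · exact hstep i (by omega)
    · rintro (_ | i) hi
      · exact hcolon
      · exact hcol i (by omega)
    · rintro (_ | i) (_ | j) hij hj
      · omega
      · exact hcard j (by omega)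
      · omega
      · exact hmono i j (by omega) (by omega)

lemma TransversalChain.hasPrettyCleanFiltration {r : ℕ} {J : Ideal (PolRing k n d)}
    (h : TransversalChain r J) :
    HasPrettyCleanFiltration (PolRing k n d) (PolRing k n d ⧸ J) := by
  obtain ⟨t, K, f, F, h0, ht, -, hstep, hcol, hmono⟩ := h.exists_sequence
  have hJ : ∀ i ≤ t, J ≤ K i := by
    intro i
    induction i with
    | zero => exact fun _ => h0.ge
    | succ i ih =>
      intro hi
      rw [hstep i (by omega)]
      exact (ih (by omega)).trans le_sup_left
  refine ⟨t, fun i => Submodule.map J.mkQ (K i.val), fun i => varIdeal k (F i.val), ?_, ?_, ?_, ?_⟩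
  · beta_reduce
    rw [Fin.val_zero, h0]
    exact Submodule.mkQ_map_self J
  · beta_reduce
    rw [Fin.val_last, ht, Submodule.map_top, Submodule.range_mkQ]
  · intro i
    have hmap : Submodule.map J.mkQ (K i.succ.val) =
        Submodule.map J.mkQ (K i.castSucc.val) ⊔ Submodule.span (PolRing k n d) {J.mkQ (f i)} := by
      rw [Fin.val_succ, hstep i i.2, Submodule.map_sup, Ideal.span, Submodule.map_span,
        Set.image_singleton]
      rfl
    beta_reduce
    refine ⟨hmap ▸ le_sup_left, isPrime_varIdeal, ?_⟩
    rw [hmap]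
    refine nonempty_quotient_sup_span_equiv fun g => ?_
    rw [← hcol i i.2 g, ← map_smul, ← Submodule.mem_comap, Submodule.comap_map_mkQ,
      sup_eq_right.mpr (hJ _ i.castSucc.is_le)]
    rfl
  · intro i j hij hle
    exact congrArg (varIdeal k)
      (Finset.eq_of_subset_of_card_le (varIdeal_le_iff.mp hle) (hmono i j hij j.2))

end Chains

/-! ### Borel moves and partial sums. -/

section BorelMoves

variable {n : ℕ}

/-- The exponent vector of `(x_j / x_i) x^a`. -/
noncomputable def move (a : Fin n →₀ ℕ) (i j : Fin n) : Fin n →₀ ℕ :=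
  a - Finsupp.single i 1 + Finsupp.single j 1

/-- The additive form avoids truncated subtraction and covers `i = j` as well. -/
lemma move_apply_add {a : Fin n →₀ ℕ} {i : Fin n} (hi : 0 < a i) (j l : Fin n) :
    move a i j l + (if l = i then 1 else 0) = a l + (if l = j then 1 else 0) := by
  simp only [move, Finsupp.add_apply, Finsupp.tsub_apply, Finsupp.single_apply]
  by_cases h : i = l
  · subst h
    simp only [if_true]
    by_cases h' : j = i
    · simp [h']; omega
    · simp [h', Ne.symm h']; omega
  · simp [h, Ne.symm h, eq_comm]

/-- The weight `∑ i a_i`, which decreases under Borel moves. -/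
def weight (a : Fin n →₀ ℕ) : ℕ := ∑ i, i.val * a i

lemma weight_move_lt {a : Fin n →₀ ℕ} {i j : Fin n} (hi : 0 < a i) (hji : j < i) :
    weight (move a i j) < weight a := by
  have h : ∑ l : Fin n, l.val * (move a i j l + (if l = i then 1 else 0)) =
      ∑ l : Fin n, l.val * (a l + (if l = j then 1 else 0)) :=
    Finset.sum_congr rfl fun l _ => by rw [move_apply_add hi]
  simp only [mul_add, Finset.sum_add_distrib, mul_ite, mul_one, mul_zero, Finset.sum_ite_eq',
    Finset.mem_univ, if_true] at h
  have : j.val < i.val := hji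
  unfold weight
  omega

variable (A : Finset (Fin n))

/-- The partial sum of `a` over the elements of `A` below `m`. -/
def psum (a : Fin n →₀ ℕ) (m : ℕ) : ℕ := ∑ l ∈ A with l.val < m, a l

variable {A}

lemma psum_zero (a : Fin n →₀ ℕ) : psum A a 0 = 0 := by simp [psum]

lemma psum_succ_of_mem (a : Fin n →₀ ℕ) {i : Fin n} (hi : i ∈ A) :
    psum A a (i.val + 1) = psum A a i.val + a i := by
  have : A.filter (fun l => l.val < i.val + 1) = insert i (A.filter fun l => l.val < i.val) := by
    ext l
    simp only [Finset.mem_filter, Finset.mem_insert, Fin.ext_iff]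
    constructor
    · rintro ⟨h, h'⟩
      by_cases e : l.val = i.val
      · exact Or.inl e
      · exact Or.inr ⟨h, by omega⟩
    · rintro (h | h)
      · exact ⟨by rwa [Fin.ext h], by omega⟩
      · exact ⟨h.1, by omega⟩
  rw [psum, this, Finset.sum_insert (by simp), add_comm]
  rfl

lemma psum_succ_of_forall_notMem (a : Fin n →₀ ℕ) {m : ℕ} (hm : ∀ i : Fin n, i.val = m → i ∉ A) :
    psum A a (m + 1) = psum A a m := by
  unfold psum
  refine Finset.sum_congr (Finset.filter_congr fun l hl => ?_) fun _ _ => rfl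
  have := hm l
  constructor
  · intro h
    by_contra h'
    exact this (by omega) hl
  · omega

lemma psum_congr {a b : Fin n →₀ ℕ} {m : ℕ} (h : ∀ l ∈ A, l.val < m → a l = b l) :
    psum A a m = psum A b m :=
  Finset.sum_congr rfl fun l hl => h l (Finset.mem_filter.mp hl).1 (Finset.mem_filter.mp hl).2

lemma psum_le_degree (a : Fin n →₀ ℕ) (m : ℕ) : psum A a m ≤ a.degree := by
  rw [Finsupp.degree_eq_sum]
  exact Finset.sum_le_sum_of_subset (Finset.subset_univ _)

lemma psum_move_add {a : Fin n →₀ ℕ} {i : Fin n} (hi : 0 < a i) (hiA : i ∈ A) {j : Fin n}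
    (hjA : j ∈ A) (m : ℕ) :
    psum A (move a i j) m + (if i.val < m then 1 else 0) =
      psum A a m + (if j.val < m then 1 else 0) := by
  have h : ∑ l ∈ A with l.val < m, (move a i j l + (if l = i then 1 else 0)) =
      ∑ l ∈ A with l.val < m, (a l + (if l = j then 1 else 0)) :=
    Finset.sum_congr rfl fun l _ => by rw [move_apply_add hi]
  simpa only [psum, Finset.sum_add_distrib, Finset.sum_ite_eq', Finset.mem_filter, hiA, hjA,
    true_and] using h

lemma psum_add_single (a : Fin n →₀ ℕ) {i : Fin n} (hiA : i ∈ A) (m : ℕ) :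
    psum A (a + Finsupp.single i 1) m = psum A a m + (if i.val < m then 1 else 0) := by
  have : ∀ l, Finsupp.single i 1 l = if l = i then 1 else 0 := fun l => by
    simp [Finsupp.single_apply, eq_comm]
  simp only [psum, Finsupp.add_apply, Finset.sum_add_distrib, this, Finset.sum_ite_eq',
    Finset.mem_filter, hiA, true_and]

/-- An upper set of exponent vectors that is closed under Borel moves, and whose minimal elements
have degree at most `d`. -/
structure IsBorelSet (d : ℕ) (U : Set (Fin n →₀ ℕ)) : Prop where
  upper : ∀ a ∈ U, ∀ b, a ≤ b → b ∈ U
  borel : ∀ a ∈ U, ∀ i j : Fin n, 0 < a i → j < i → move a i j ∈ U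
  bounded : ∀ a ∈ U, d < a.degree → ∃ i, 0 < a i ∧ a - Finsupp.single i 1 ∈ U

/-- Membership in a Borel set only depends on domination of partial sums. -/
lemma IsBorelSet.mem_of_psum_le {d : ℕ} {U : Set (Fin n →₀ ℕ)} (hU : IsBorelSet d U)
    {g u : Fin n →₀ ℕ} (hg : g ∈ U) (hpol : ∀ i, i ∉ A → g i ≤ u i)
    (hA : ∀ m, psum A g m ≤ psum A u m) : u ∈ U := by
  induction hw : weight g using Nat.strong_induction_on generalizing g with
  | _ w ih =>
    by_cases hle : g ≤ u
    · exact hU.upper g hg u hle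
    -- Take the first variable in which `g` exceeds `u`; it lies in `A`. Domination of partial sums
    -- then forces an earlier `j ∈ A` with room, and one factor `x_i` is moved to `x_j`.
    obtain ⟨i, hi, hmin⟩ : ∃ i, u i < g i ∧ ∀ l < i, g l ≤ u l := by
      have hne : ∃ i, u i < g i := by
        by_contra! h
        exact hle h
      obtain ⟨i, hi, hmin⟩ := WellFounded.has_min (wellFounded_lt (α := Fin n)) {i | u i < g i} hne
      exact ⟨i, hi, fun l hl => not_lt.mp fun h => hmin l h hl⟩
    have hiA : i ∈ A := by
      by_contra h
      exact absurd (hpol i h) (by omega)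
    have hlt : psum A g i.val < psum A u i.val := by
      have := hA (i.val + 1)
      rw [psum_succ_of_mem g hiA, psum_succ_of_mem u hiA] at this
      omega
    obtain ⟨j, hj, hju⟩ := Finset.exists_lt_of_sum_lt hlt
    rw [Finset.mem_filter] at hj
    have hi0 : 0 < g i := by omega
    refine ih _ (hw ▸ weight_move_lt hi0 hj.2) (hU.borel g hg i j hi0 hj.2) ?_ ?_ rfl
    · intro l hl
      have := move_apply_add hi0 j l
      rw [if_neg (fun h : l = i => hl (h ▸ hiA)), if_neg (fun h : l = j => hl (h ▸ hj.1))] at this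
      have := hpol l hl
      omega
    · intro m
      have h := psum_move_add hi0 hiA hj.1 m
      have hm := hA m
      have hji := hj.2
      by_cases h₁ : j.val < m
      · by_cases h₂ : i.val < m
        · simp only [h₁, h₂, if_true] at h
          omega
        -- For `j < m ≤ i` the move raises the partial sum by one; there is room, since `g ≤ u`
        -- below `i`, strictly at `j`.
        · have : psum A g m < psum A u m := by
            refine Finset.sum_lt_sum (fun l hl => hmin l ?_) ⟨j, ?_, hju⟩
            · have := (Finset.mem_filter.mp hl).2
              exact Fin.lt_def.mpr (by omega)
            · exact Finset.mem_filter.mpr ⟨hj.1, h₁⟩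
          simp only [h₁, h₂, if_true, if_false] at h
          omega
      · simp only [h₁, if_false] at h
        omega

end BorelMoves

/-! ### Cells occupied by a polarized monomial. -/

section Cells

variable {n d : ℕ} {A : Finset (Fin n)}

/-- The first column used by row `i` in the mixed box polarization. -/
def rowStart (A : Finset (Fin n)) (a : Fin n →₀ ℕ) (i : Fin n) : ℕ :=
  if i ∈ A then psum A a i.val else 0

/-- The set of variables dividing the mixed box polarization of `x^a`. -/
def cells (d : ℕ) (A : Finset (Fin n)) (a : Fin n →₀ ℕ) : Finset (Fin n × Fin d) :=
  {v | rowStart A a v.1 ≤ v.2.val ∧ v.2.val < rowStart A a v.1 + a v.1}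

lemma mem_cells {a : Fin n →₀ ℕ} {v : Fin n × Fin d} :
    v ∈ cells d A a ↔ rowStart A a v.1 ≤ v.2.val ∧ v.2.val < rowStart A a v.1 + a v.1 := by
  simp [cells]

lemma rowStart_add_le_degree (a : Fin n →₀ ℕ) (i : Fin n) :
    rowStart A a i + a i ≤ a.degree := by
  by_cases h : i ∈ A
  · rw [rowStart, if_pos h, ← psum_succ_of_mem a h]
    exact psum_le_degree a _
  · rw [rowStart, if_neg h, zero_add]
    exact Finsupp.le_degree i a

lemma rowStart_congr {a b : Fin n →₀ ℕ} {i : Fin n} (h : ∀ l < i, a l = b l) :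
    rowStart A a i = rowStart A b i := by
  unfold rowStart
  rw [psum_congr fun l _ hl => h l hl]

lemma sum_filter_Iio (a : Fin n →₀ ℕ) (i : Fin n) :
    ∑ l ∈ Finset.Iio i, a.filter (· ∈ A) l = psum A a i.val := by
  simp only [Finsupp.filter_apply, psum]
  rw [← Finset.sum_filter]
  refine Finset.sum_congr ?_ fun _ _ => rfl
  ext l
  simp [and_comm]

/-- Row by row only one of the two factors contributes: `pol` is trivial on rows in `A`, and `box`
on the others. -/
lemma mixedBox_eq_prod (k : Type u) [Field k] (a : Fin n →₀ ℕ) :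
    mixedBox k d A a = ∏ v ∈ cells d A a, MvPolynomial.X v := by
  rw [mixedBox, box, pol, ← Finset.prod_mul_distrib, cells, Finset.prod_filter,
    Fintype.prod_prod_type]
  refine Finset.prod_congr rfl fun i _ => ?_
  have hIic : ∑ l ∈ Finset.Iic i, a.filter (· ∈ A) l = psum A a i.val + a.filter (· ∈ A) i := by
    rw [← Finset.Iio_insert, Finset.sum_insert (by simp), sum_filter_Iio, add_comm]
  rw [hIic, sum_filter_Iio, ← Finset.prod_filter]
  by_cases h : i ∈ A
  · rw [Finsupp.filter_apply_pos _ _ h, Finsupp.filter_apply_neg (· ∉ A) _ (not_not.mpr h)]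
    simp [rowStart, h]
  · rw [Finsupp.filter_apply_neg _ _ h, Finsupp.filter_apply_pos (· ∉ A) _ h]
    simp only [rowStart, h, if_false, add_zero, zero_add, zero_le, true_and]
    rw [Finset.filter_false_of_mem fun j _ => by omega, Finset.prod_empty, one_mul]

end Cells

/-! ### Corners, colon ideals and construction of the chain. -/

section BoxIdeal

variable {k : Type u} [Field k] {n d : ℕ} {A : Finset (Fin n)} {U : Set (Fin n →₀ ℕ)}

open MvPolynomial

/-- The squarefree monomial of a set of cells. -/
noncomputable def cellMonomial (k : Type u) [Field k] (B : Finset (Fin n × Fin d)) :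
    PolRing k n d :=
  ∏ v ∈ B, X v

/-- The ideal generated by the mixed box polarizations of the monomials of degree at most `d`
in `U`. -/
noncomputable def boxIdeal (k : Type u) [Field k] (d : ℕ) (A : Finset (Fin n))
    (U : Set (Fin n →₀ ℕ)) : Ideal (PolRing k n d) :=
  Ideal.span ((fun a => cellMonomial k (cells d A a)) '' {a | a ∈ U ∧ a.degree ≤ d})

lemma cellMonomial_mem_of_subset {J : Ideal (PolRing k n d)} {B C : Finset (Fin n × Fin d)}
    (hB : cellMonomial k B ∈ J) (h : B ⊆ C) : cellMonomial k C ∈ J :=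
  J.mem_of_dvd (Finset.prod_dvd_prod_of_subset _ _ _ h) hB

lemma cellMonomial_mem_boxIdeal {a : Fin n →₀ ℕ} (ha : a ∈ U) (hd : a.degree ≤ d) :
    cellMonomial k (cells d A a) ∈ boxIdeal k d A U :=
  Ideal.subset_span ⟨a, ⟨ha, hd⟩, rfl⟩

/-- The exponents of the variables of index at least `r` do not matter for membership in `U`. -/
def IsTruncated (r : ℕ) (U : Set (Fin n →₀ ℕ)) : Prop :=
  ∀ a ∈ U, a.filter (fun i => i.val < r) ∈ U

/-- `u` is a maximal monomial outside `U` that is multiplied into `U` by the first `r`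
variables. -/
structure IsCorner (d r : ℕ) (U : Set (Fin n →₀ ℕ)) (u : Fin n →₀ ℕ) : Prop where
  notMem : u ∉ U
  support : ∀ i : Fin n, r ≤ i.val → u i = 0
  add_mem : ∀ i : Fin n, i.val < r → u + Finsupp.single i 1 ∈ U
  move_mem : ∀ i j : Fin n, 0 < u i → j < i → move u i j ∈ U
  degree_lt : u.degree < d

/-- Let `x` be the variable of index `r`. Among the monomials `u ∉ U` in the first `r + 1` variables
with `x u ∈ U`, choose one of least weight. A Borel move of `u` outside `U` would be a lighter
candidate, and moving `x` down in `x u` gives the other products. -/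
lemma IsBorelSet.exists_isCorner (hU : IsBorelSet d U) {r : ℕ} (hr : r < n)
    (h₁ : IsTruncated (r + 1) U) (h₀ : ¬IsTruncated r U) : ∃ u, IsCorner d (r + 1) U u := by
  let x : Fin n := ⟨r, hr⟩
  let V : Set (Fin n →₀ ℕ) :=
    {u | u ∉ U ∧ (∀ i : Fin n, r + 1 ≤ i.val → u i = 0) ∧ u + Finsupp.single x 1 ∈ U}
  have hV : V.Nonempty := by
    unfold IsTruncated at h₀
    push Not at h₀
    obtain ⟨a, ha, hb⟩ := h₀
    set b := a.filter fun i => i.val < r with hbdef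
    -- The least such `c` is positive, so `c - 1` gives a candidate.
    have hex : ∃ c, b + Finsupp.single x c ∈ U := by
      refine ⟨a x, ?_⟩
      convert h₁ a ha using 1
      ext i
      simp only [hbdef, Finsupp.add_apply, Finsupp.filter_apply, Finsupp.single_apply]
      by_cases hi : x = i
      · subst hi
        simp [x]
      · have : i.val ≠ r := fun h => hi (Fin.ext h.symm)
        have e : i.val < r + 1 ↔ i.val < r := by omega
        simp [hi, e]
    classical
    have hc := Nat.find_spec hex
    set c := Nat.find hex with hcdef
    have hc0 : c ≠ 0 := by
      intro h
      rw [h, Finsupp.single_zero, add_zero] at hc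
      exact hb hc
    refine ⟨b + Finsupp.single x (c - 1), Nat.find_min hex (by omega), fun i hi => ?_, ?_⟩
    · have : x ≠ i := fun h => by
        rw [← h] at hi
        simp only [x] at hi
        omega
      simp only [hbdef, Finsupp.add_apply, Finsupp.filter_apply, Finsupp.single_apply]
      rw [if_neg (by omega), if_neg this, add_zero]
    · rw [add_assoc, ← Finsupp.single_add, Nat.sub_add_cancel (by omega)]
      exact hc
  obtain ⟨u, ⟨hu, hsupp, hx⟩, hmin⟩ := WellFounded.has_min (measure weight).wf V hV
  have hback : ∀ i, i < x → u + Finsupp.single x 1 - Finsupp.single i 1 ∈ U → 0 < u i → u ∈ U := by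
    intro i hi h hui
    have hix : i ≠ x := ne_of_lt hi
    convert hU.borel _ h x i ?_ hi using 1
    · ext l
      simp only [move, Finsupp.add_apply, Finsupp.tsub_apply, Finsupp.single_apply]
      by_cases hl : i = l
      · subst hl
        simp [hix.symm]; omega
      · simp [hl]
    · simp [hix]
  refine ⟨u, hu, hsupp, fun i hi => ?_, fun i j hi hji => ?_, ?_⟩
  · by_cases hix : i = x
    · exact hix ▸ hx
    · have hlt : i < x := Fin.lt_def.mpr (by
        have : i.val ≠ r := fun h => hix (Fin.ext h)
        simp only [x]
        omega)
      convert hU.borel _ hx x i (by simp) hlt using 1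
      simp [move]
  · by_contra hm
    refine hmin (move u i j) ⟨hm, fun l hl => ?_, ?_⟩ (weight_move_lt hi hji)
    · have hi' : i.val < r + 1 := by
        by_contra h
        have := hsupp i (by omega)
        omega
      have hji' : j.val < i.val := hji
      have := move_apply_add hi j l
      rw [if_neg (fun h => by subst h; omega), if_neg (fun h => by subst h; omega),
        hsupp l hl] at this
      omega
    · convert hU.borel _ hx i j (by simp; omega) hji using 1
      ext l
      simp only [move, Finsupp.add_apply, Finsupp.tsub_apply, Finsupp.single_apply]
      by_cases hl : i = l
      · subst hl
        simp; omega
      · simp [hl]; omega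
  · by_contra hdeg
    -- If `deg u ≥ d`, then `x u` is not minimal in `U`: some `x_i` can be dropped, and moving `x`
    -- to `x_i` puts `u` itself into `U`.
    obtain ⟨i, hi, hi'⟩ := hU.bounded _ hx (by simp [map_add]; omega)
    rcases lt_trichotomy i x with h | h | h
    · refine hu (hback i h hi' ?_)
      simpa [h.ne] using hi
    · subst h
      exact hu (by simpa using hi')
    · have h' : r < i.val := h
      rw [Finsupp.add_apply, hsupp i (by omega)] at hi
      simp [h.ne'] at hi

variable {r : ℕ} {u : Fin n →₀ ℕ}

lemma IsCorner.rowStart_add_lt (hu : IsCorner d r U u) (i : Fin n) : rowStart A u i + u i < d :=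
  lt_of_le_of_lt (rowStart_add_le_degree u i) hu.degree_lt

/-- The first free cell of each of the first `r` rows. -/
def IsCorner.freeCells (hu : IsCorner d r U u) (A : Finset (Fin n)) : Finset (Fin n × Fin d) :=
  Finset.image (fun i => (i, ⟨rowStart A u i + u i, hu.rowStart_add_lt i⟩))
    {i : Fin n | i.val < r}

lemma IsCorner.mem_freeCells (hu : IsCorner d r U u) {v : Fin n × Fin d} :
    v ∈ hu.freeCells A ↔ v.1.val < r ∧ v.2.val = rowStart A u v.1 + u v.1 := by
  simp only [freeCells, Finset.mem_image, Finset.mem_filter, Finset.mem_univ, true_and]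
  constructor
  · rintro ⟨i, hi, rfl⟩
    exact ⟨hi, rfl⟩
  · rintro ⟨h, h'⟩
    exact ⟨v.1, h, Prod.ext rfl (Fin.ext h'.symm)⟩

lemma IsCorner.card_freeCells (hu : IsCorner d r U u) (hr : r ≤ n) :
    (hu.freeCells A).card = r := by
  rw [freeCells, Finset.card_image_of_injective _ fun i j h => (Prod.ext_iff.mp h).1,
    Fin.card_filter_val_lt, min_eq_right hr]

lemma IsCorner.isTransversal_freeCells (hu : IsCorner d r U u) :
    IsTransversal (hu.freeCells A) := by
  intro v hv w hw h
  rw [mem_freeCells] at hv hw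
  refine Prod.ext h (Fin.ext ?_)
  rw [hv.2, hw.2, h]

lemma IsCorner.disjoint_freeCells (hu : IsCorner d r U u) :
    cellMonomial k (cells d A u) ∉ varIdeal k (hu.freeCells A) := by
  rw [cellMonomial, prod_X_mem_varIdeal_iff]
  rintro ⟨v, hv, hv'⟩
  rw [mem_cells] at hv
  rw [mem_freeCells] at hv'
  omega

/-- Suppose the cells of `g` miss all free cells of `u`. A row of `g` that starts no later than the
free cell of `u` must also end no later, so by induction on rows the partial sums of the truncation
of `g` are dominated by those of `u`, forcing `u ∈ U`. -/
lemma IsCorner.boxIdeal_le_varIdeal (hu : IsCorner d r U u) (hU : IsBorelSet d U)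
    (hr : IsTruncated r U) : boxIdeal k d A U ≤ varIdeal k (hu.freeCells A) := by
  refine Ideal.span_le.mpr ?_
  rintro _ ⟨g, ⟨hg, -⟩, rfl⟩
  refine prod_X_mem_varIdeal_iff.mpr ?_
  by_contra hcon
  refine hu.notMem (hU.mem_of_psum_le (A := A) (hr g hg) ?_ ?_)
  all_goals
    have hfree : ∀ i : Fin n, i.val < r → rowStart A g i ≤ rowStart A u i + u i →
        rowStart A g i + g i ≤ rowStart A u i + u i := by
      intro i hi h
      by_contra h'
      exact hcon ⟨(i, ⟨rowStart A u i + u i, hu.rowStart_add_lt i⟩),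
        mem_cells.mpr ⟨h, not_le.mp h'⟩, hu.mem_freeCells.mpr ⟨hi, rfl⟩⟩
  · intro i hi
    rw [Finsupp.filter_apply]
    split_ifs with h
    · simpa [rowStart, hi] using hfree i h (by simp [rowStart, hi])
    · exact Nat.zero_le _
  · intro m
    induction m with
    | zero => rw [psum_zero, psum_zero]
    | succ m ih =>
      by_cases hm : ∃ i : Fin n, i.val = m ∧ i ∈ A
      · obtain ⟨i, rfl, hi⟩ := hm
        rw [psum_succ_of_mem _ hi, psum_succ_of_mem _ hi, Finsupp.filter_apply]
        split_ifs with h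
        · have e : psum A (g.filter fun i => i.val < r) i.val = psum A g i.val :=
            psum_congr fun l _ hl => Finsupp.filter_apply_pos _ _ (by omega)
          have := hfree i h
          simp only [rowStart, hi, if_true] at this
          rw [e] at ih ⊢
          exact this (by omega)
        · omega
      · push Not at hm
        rw [psum_succ_of_forall_notMem _ hm, psum_succ_of_forall_notMem _ hm]
        exact ih

/-- If `i ∈ A` and a later row of `A` is nonempty, let `j` be the first one and use `(x_i / x_j) u`:
row `i` gains the free cell, row `j` loses its first cell, the rows of `A` in between are empty, and
later ones do not shift. In the remaining cases `x_i u` shifts no nonempty row. The degree stays at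
most `d` because `deg u < d`. -/
lemma IsCorner.X_mul_mem (hu : IsCorner d r U u) {v : Fin n × Fin d} (hv : v ∈ hu.freeCells A) :
    X v * cellMonomial k (cells d A u) ∈ boxIdeal k d A U := by
  have hnot : v ∉ cells d A u := by
    rw [hu.mem_freeCells] at hv
    rw [mem_cells]
    omega
  obtain ⟨i, c⟩ := v
  obtain ⟨hir, hc⟩ := hu.mem_freeCells.mp hv
  simp only at hir hc
  have hprod : X (i, c) * cellMonomial k (cells d A u) =
      cellMonomial k (insert (i, c) (cells d A u)) := (Finset.prod_insert hnot).symm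
  rw [hprod]
  suffices ∃ a ∈ U, a.degree ≤ d ∧ ∀ l, ∀ m : ℕ,
      rowStart A a l ≤ m → m < rowStart A a l + a l →
        (l = i ∧ m = rowStart A u i + u i) ∨ (rowStart A u l ≤ m ∧ m < rowStart A u l + u l) by
    obtain ⟨a, ha, had, hsub⟩ := this
    refine cellMonomial_mem_of_subset (cellMonomial_mem_boxIdeal ha had) fun w hw => ?_
    rw [mem_cells] at hw
    rw [Finset.mem_insert]
    rcases hsub w.1 w.2.val hw.1 hw.2 with ⟨h, h'⟩ | h
    · exact Or.inl (Prod.ext h (Fin.ext (h'.trans hc.symm)))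
    · exact Or.inr (mem_cells.mpr h)
  have hdeg := hu.degree_lt
  by_cases hiA : i ∈ A
  · by_cases hnext : ∃ j ∈ A, i < j ∧ 0 < u j
    · obtain ⟨j, ⟨hjA, hij, hj⟩, hmin⟩ := WellFounded.has_min (wellFounded_lt (α := Fin n))
        {j | j ∈ A ∧ i < j ∧ 0 < u j} hnext
      refine ⟨move u j i, hu.move_mem j i hj hij, ?_, fun l m => ?_⟩
      · have := Finset.sum_congr (rfl : (Finset.univ : Finset (Fin n)) = Finset.univ)
          fun l _ => move_apply_add hj i l
        simp only [Finset.sum_add_distrib, Finset.sum_ite_eq', Finset.mem_univ, if_true] at this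
        rw [Finsupp.degree_eq_sum] at hdeg ⊢
        omega
      · have hl := move_apply_add hj i l
        by_cases hlA : l ∈ A
        · have hp := psum_move_add hj hjA hiA l.val
          have hzero : i < l → l < j → u l = 0 := fun h h' => by
            by_contra h0
            exact hmin l ⟨hlA, h, Nat.pos_of_ne_zero h0⟩ h'
          simp only [rowStart, hlA, hiA, if_true]
          simp only [Fin.lt_def] at hzero hij
          by_cases h : l = i
          · subst h
            split_ifs at hl hp <;> omega
          · by_cases h' : l = j
            · subst h'
              split_ifs at hl hp <;> omega
            · have : l.val ≠ i.val := fun e => h (Fin.ext e)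
              have : l.val ≠ j.val := fun e => h' (Fin.ext e)
              split_ifs at hl hp <;> omega
        · have h1 : l ≠ i := fun h => hlA (h ▸ hiA)
          have h2 : l ≠ j := fun h => hlA (h ▸ hjA)
          simp only [h1, h2, if_false] at hl
          simp only [rowStart, hlA, if_false]
          omega
    · push Not at hnext
      refine ⟨u + Finsupp.single i 1, hu.add_mem i hir, by simp [map_add]; omega, fun l m => ?_⟩
      by_cases hlA : l ∈ A
      · have hp := psum_add_single u hiA l.val
        have hz := hnext l hlA
        simp only [rowStart, hlA, hiA, if_true, hp, Finsupp.add_apply, Finsupp.single_apply]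
        simp only [Fin.lt_def] at hz
        simp only [Fin.ext_iff]
        by_cases h : i.val = l.val
        · obtain rfl := Fin.ext h
          simp
          omega
        · simp only [h, if_false]
          split_ifs <;> omega
      · have h1 : i ≠ l := fun h => hlA (h ▸ hiA)
        simp only [rowStart, hlA, if_false, Finsupp.add_apply, Finsupp.single_apply, h1]
        omega
  · refine ⟨u + Finsupp.single i 1, hu.add_mem i hir, by simp [map_add]; omega, fun l m => ?_⟩
    have hp : ∀ m, psum A (u + Finsupp.single i 1) m = psum A u m := fun m =>
      psum_congr fun l hl _ => by
        have : i ≠ l := fun h => hiA (h ▸ hl)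
        simp [this]
    by_cases h : i = l
    · subst h
      simp [rowStart, hiA]
      omega
    · simp only [rowStart, hp, Finsupp.add_apply, Finsupp.single_apply, h, if_false]
      omega

lemma IsCorner.mul_mem_boxIdeal_iff (hu : IsCorner d r U u) (hU : IsBorelSet d U)
    (hr : IsTruncated r U) (g : PolRing k n d) :
    g * cellMonomial k (cells d A u) ∈ boxIdeal k d A U ↔ g ∈ varIdeal k (hu.freeCells A) := by
  constructor
  · intro h
    exact (isPrime_varIdeal.mem_or_mem (hu.boxIdeal_le_varIdeal hU hr h)).resolve_right
      hu.disjoint_freeCells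
  · intro h
    refine (Ideal.span_le (I := (boxIdeal k d A U).colon {cellMonomial k (cells d A u)})).mpr ?_ h
      |> Submodule.mem_colon_singleton.mp
    rintro _ ⟨v, hv, rfl⟩
    exact Submodule.mem_colon_singleton.mpr (hu.X_mul_mem hv)

/-- A multiple `a` of `u` outside `U` agrees with `u` in the first `r` exponents, as otherwise it
would be a multiple of some `x_i u ∈ U`. Its first `r` rows are thus those of `u`, and `u` has no
others. -/
lemma IsCorner.boxIdeal_union (hu : IsCorner d r U u) (hU : IsBorelSet d U) :
    boxIdeal k d A (U ∪ Set.Ici u) =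
      boxIdeal k d A U ⊔ Ideal.span {cellMonomial k (cells d A u)} := by
  apply le_antisymm
  · refine Ideal.span_le.mpr ?_
    rintro _ ⟨a, ⟨ha, had⟩, rfl⟩
    by_cases haU : a ∈ U
    · exact Ideal.mem_sup_left (cellMonomial_mem_boxIdeal haU had)
    · have hua : u ≤ a := ha.resolve_left haU
      have heq : ∀ i : Fin n, i.val < r → u i = a i := by
        intro i hi
        refine le_antisymm (hua i) (not_lt.mp fun h => haU (hU.upper _ (hu.add_mem i hi) a ?_))
        intro l
        have := hua l
        rw [Finsupp.add_apply, Finsupp.single_apply]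
        split_ifs with h'
        · subst h'
          omega
        · simpa using this
      refine Ideal.mem_sup_right (cellMonomial_mem_of_subset
        (Ideal.mem_span_singleton_self _) fun v hv => ?_)
      rw [mem_cells] at hv ⊢
      by_cases hv1 : v.1.val < r
      · rw [← rowStart_congr (a := u) (b := a) fun l hl => heq l (lt_trans hl hv1), ← heq _ hv1]
        exact hv
      · rw [hu.support v.1 (by omega)] at hv
        omega
  · refine sup_le (Ideal.span_mono (Set.image_mono fun a ha => ⟨Or.inl ha.1, ha.2⟩)) ?_
    rw [Ideal.span_singleton_le_iff_mem]
    exact cellMonomial_mem_boxIdeal (Or.inr (Set.mem_Ici.mpr le_rfl)) hu.degree_lt.le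

/-- A move at `x_i` on a multiple `a` of `u` stays above `u` if `a i > u i`; if `a i = u i`, it is a
multiple of the same move of `u`, which lies in `U`. -/
lemma IsCorner.isBorelSet_union (hu : IsCorner d r U u) (hU : IsBorelSet d U) :
    IsBorelSet d (U ∪ Set.Ici u) where
  upper := by
    rintro a (ha | ha) b hab
    · exact Or.inl (hU.upper a ha b hab)
    · exact Or.inr (le_trans ha hab)
  borel := by
    rintro a (ha | ha) i j hi hji
    · exact Or.inl (hU.borel a ha i j hi hji)
    · have ha' : ∀ l, u l ≤ a l := ha
      by_cases h : u i < a i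
      · refine Or.inr fun l => ?_
        have h₁ := move_apply_add hi j l
        have h₂ := ha' l
        by_cases hl : l = i
        · subst hl
          simp only [if_true] at h₁
          omega
        · simp only [hl, if_false] at h₁
          omega
      · have hui : 0 < u i := by have := ha' i; omega
        refine Or.inl (hU.upper _ (hu.move_mem i j hui hji) _ fun l => ?_)
        have h₁ := move_apply_add hi j l
        have h₂ := move_apply_add hui j l
        have h₃ := ha' l
        omega
  bounded := by
    rintro a (ha | ha) hd
    · obtain ⟨i, hi, h⟩ := hU.bounded a ha hd
      exact ⟨i, hi, Or.inl h⟩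
    · have ha' : ∀ l, u l ≤ a l := ha
      obtain ⟨i, hi⟩ : ∃ i, u i < a i := by
        by_contra! h
        have : a = u := le_antisymm h ha
        subst this
        exact absurd hu.degree_lt (by omega)
      refine ⟨i, by omega, Or.inr fun l => ?_⟩
      have := ha' l
      rw [Finsupp.tsub_apply, Finsupp.single_apply]
      split_ifs with h
      · subst h
        omega
      · omega

lemma IsCorner.isTruncated_union (hu : IsCorner d r U u) (hr : IsTruncated r U) :
    IsTruncated r (U ∪ Set.Ici u) := by
  rintro a (ha | ha)
  · exact Or.inl (hr a ha)
  · refine Or.inr fun l => ?_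
    have : u l ≤ a l := ha l
    rw [Finsupp.filter_apply]
    split_ifs with h
    · exact this
    · rw [hu.support l (by omega)]

lemma transversalChain_bot (r : ℕ) : TransversalChain r (⊥ : Ideal (PolRing k n d)) := by
  refine .step (f := 1) (F := ∅) (by simp [IsTransversal]) (by simp)
    (fun g => by simp [varIdeal]) ?_
  rw [Ideal.span_singleton_one, sup_top_eq]
  exact .top _

/-- Noetherian induction on the ideal, with an inner induction on `r`: lower `r` if the truncation
allows it, otherwise adjoin a corner and keep `r`. At `r = 0` the set `U` is empty or everything. -/
lemma IsBorelSet.transversalChain (hU : IsBorelSet d U) {r : ℕ} (hrn : r ≤ n)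
    (hr : IsTruncated r U) : TransversalChain r (boxIdeal k d A U) := by
  induction hJ : boxIdeal k d A U using WellFoundedGT.induction generalizing U r with
  | _ J ih =>
    induction r with
    | zero =>
      by_cases hne : ∃ a, a ∈ U
      · obtain ⟨a, ha⟩ := hne
        have h0 : (0 : Fin n →₀ ℕ) ∈ U := by
          convert hr a ha using 1
          ext i
          simp
        have : J = ⊤ := by
          rw [← hJ, Ideal.eq_top_iff_one]
          have := cellMonomial_mem_boxIdeal (k := k) (A := A) h0 (d := d) (by simp)
          have hc : cells d A (0 : Fin n →₀ ℕ) = ∅ := by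
            ext v
            rw [mem_cells]
            simp
          rwa [hc, cellMonomial, Finset.prod_empty] at this
        rw [this]
        exact .top _
      · have : J = ⊥ := by
          push Not at hne
          rw [← hJ, boxIdeal, Set.eq_empty_of_forall_notMem hne]
          simp
        rw [this]
        exact transversalChain_bot _
    | succ r ihr =>
      by_cases h : IsTruncated r U
      · exact (ihr (by omega) h).mono (by omega)
      · obtain ⟨u, hu⟩ := hU.exists_isCorner hrn hr h
        have hcol := hu.mul_mem_boxIdeal_iff (k := k) (A := A) hU hr
        have hun := hu.boxIdeal_union (k := k) (A := A) hU
        have hcard := hu.card_freeCells (A := A) hrn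
        rw [hJ] at hcol hun
        refine .step hu.isTransversal_freeCells hcard.le hcol ?_
        rw [hcard]
        refine ih _ ?_ (hu.isBorelSet_union hU) hrn (hu.isTruncated_union hr) hun
        refine lt_of_le_of_ne le_sup_left fun he => ?_
        have hmem : 1 * cellMonomial k (cells d A u) ∈ J := by
          rw [one_mul, he]
          exact Ideal.mem_sup_right (Ideal.mem_span_singleton_self _)
        exact isPrime_varIdeal.ne_top ((Ideal.eq_top_iff_one _).mpr ((hcol 1).mp hmem))

end BoxIdeal

/-! ### Borel fixed ideals and specialization along φ. -/

section MixedBoxIdeal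

variable {k : Type u} [Field k] {n d : ℕ} {A : Finset (Fin n)} {I : Ideal (MvPolynomial (Fin n) k)}

open MvPolynomial

/-- The exponent vectors of the monomials in `I`. -/
def exponents {σ : Type} (I : Ideal (MvPolynomial σ k)) : Set (σ →₀ ℕ) :=
  {a | monomial a (1 : k) ∈ I}

lemma mem_exponents_of_le {σ : Type} {I : Ideal (MvPolynomial σ k)} {a b : σ →₀ ℕ}
    (ha : a ∈ exponents I) (hab : a ≤ b) : b ∈ exponents I := by
  have : monomial b (1 : k) = monomial (b - a) 1 * monomial a 1 := by
    rw [monomial_mul, one_mul, tsub_add_cancel_of_le hab]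
  change monomial b (1 : k) ∈ I
  rw [this]
  exact I.mul_mem_left _ ha

lemma exists_sub_single_mem {σ : Type} {I : Ideal (MvPolynomial σ k)} {a : σ →₀ ℕ}
    (ha : a ∈ exponents I) (hmin : a ∉ minGens I) :
    ∃ i, 0 < a i ∧ a - Finsupp.single i 1 ∈ exponents I := by
  classical
  obtain ⟨b, hba, hb⟩ := (not_minimal_iff_exists_lt ha).mp hmin
  obtain ⟨i, hi⟩ : ∃ i, b i < a i := by
    by_contra! h
    exact hba.not_ge h
  refine ⟨i, by omega, mem_exponents_of_le hb fun l => ?_⟩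
  have : b l ≤ a l := hba.le l
  rw [Finsupp.tsub_apply, Finsupp.single_apply]
  split_ifs with h
  · subst h
    omega
  · omega

lemma IsBorelFixed.isBorelSet (hI : IsBorelFixed I) (hdeg : ∀ a ∈ minGens I, a.degree ≤ d) :
    IsBorelSet d (exponents I) where
  upper a ha b hab := mem_exponents_of_le ha hab
  borel a ha i j hi hji := hI.2 a i j ha hi hji
  bounded a ha had := exists_sub_single_mem ha fun h => absurd (hdeg a h) (by omega)

/-- Every monomial of a Borel fixed ideal that is not a minimal generator stays in the ideal after
removing its last variable. -/
lemma IsBorelFixed.exists_last_sub_single_mem (hI : IsBorelFixed I) {a : Fin n →₀ ℕ}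
    (ha : a ∈ exponents I) (hmin : a ∉ minGens I) :
    ∃ m, 0 < a m ∧ (∀ l, m < l → a l = 0) ∧ a - Finsupp.single m 1 ∈ exponents I := by
  obtain ⟨i, hi, hmem⟩ := exists_sub_single_mem ha hmin
  obtain ⟨m, hm, hmax⟩ := WellFounded.has_min (wellFounded_gt (α := Fin n)) {l | 0 < a l} ⟨i, hi⟩
  have hlast : ∀ l, m < l → a l = 0 := fun l hl => by
    by_contra h
    exact hmax l (Nat.pos_of_ne_zero h) hl
  refine ⟨m, hm, hlast, ?_⟩
  have hm' : 0 < a m := hm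
  rcases lt_trichotomy i m with h | h | h
  · have hne : i ≠ m := h.ne
    -- The Borel move from `x_m` to `x_i` turns `x^a / x_i` into `x^a / x_m`.
    have : a - Finsupp.single i 1 - Finsupp.single m 1 + Finsupp.single i 1 =
        a - Finsupp.single m 1 := by
      ext l
      simp only [Finsupp.add_apply, Finsupp.tsub_apply, Finsupp.single_apply]
      by_cases hl : i = l
      · subst hl
        simp [hne.symm]
        omega
      · simp [hl]
    have hmove := hI.2 _ m i hmem (by simp [hne]; omega) h
    rwa [this] at hmove
  · exact h ▸ hmem
  · exact absurd (hlast i h) (by omega)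

/-- Removing the last variable shifts no nonempty row, so it only deletes a cell; descending this
way reaches a minimal generator. Hence non-minimal monomials add nothing to the ideal. -/
lemma IsBorelFixed.cellMonomial_mem_mixedBoxIdeal (hI : IsBorelFixed I) {a : Fin n →₀ ℕ}
    (ha : a ∈ exponents I) : cellMonomial k (cells d A a) ∈ mixedBoxIdeal d A I := by
  induction hw : a.degree using Nat.strong_induction_on generalizing a with
  | _ w ih =>
    by_cases hmin : a ∈ minGens I
    · exact Ideal.subset_span ⟨a, hmin, mixedBox_eq_prod k a⟩
    · obtain ⟨m, hm, hlast, hmem⟩ := hI.exists_last_sub_single_mem ha hmin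
      have hle : Finsupp.single m 1 ≤ a := by
        rw [Finsupp.single_le_iff]
        omega
      have hdeg : (a - Finsupp.single m 1).degree + 1 = a.degree := by
        conv_rhs => rw [← tsub_add_cancel_of_le hle]
        simp
      refine cellMonomial_mem_of_subset (ih _ (by omega) hmem rfl) fun v hv => ?_
      rw [mem_cells, Finsupp.tsub_apply, Finsupp.single_apply] at hv
      rw [mem_cells]
      by_cases h : m < v.1
      · rw [hlast _ h] at hv
        omega
      · rw [rowStart_congr (b := a) fun l hl => by
          have : m ≠ l := fun e => h (e ▸ hl)
          simp [this]] at hv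
        omega

lemma IsBorelFixed.boxIdeal_exponents (hI : IsBorelFixed I)
    (hdeg : ∀ a ∈ minGens I, a.degree ≤ d) :
    boxIdeal k d A (exponents I) = mixedBoxIdeal d A I := by
  apply le_antisymm
  · refine Ideal.span_le.mpr ?_
    rintro _ ⟨a, ⟨ha, -⟩, rfl⟩
    exact hI.cellMonomial_mem_mixedBoxIdeal ha
  · refine Ideal.span_le.mpr ?_
    rintro _ ⟨a, ha, rfl⟩
    rw [mixedBox_eq_prod]
    exact cellMonomial_mem_boxIdeal ha.1 (hdeg a ha)

lemma IsBorelFixed.transversalChain (hI : IsBorelFixed I)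
    (hdeg : ∀ a ∈ minGens I, a.degree ≤ d) : TransversalChain n (mixedBoxIdeal d A I) := by
  rw [← hI.boxIdeal_exponents hdeg]
  refine (hI.isBorelSet hdeg).transversalChain le_rfl fun a ha => ?_
  convert ha using 1
  ext i
  simp

lemma isSquarefreeMonomialIdeal_mixedBoxIdeal :
    IsSquarefreeMonomialIdeal (mixedBoxIdeal d A I) := by
  classical
  refine ⟨(fun a => ∑ v ∈ cells d A a, Finsupp.single v 1) '' minGens I, ?_, ?_⟩
  · rintro _ ⟨a, -, rfl⟩ v
    simp only [Finsupp.finsetSum_apply, Finsupp.single_apply, Finset.sum_ite_eq']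
    split_ifs <;> omega
  · rw [mixedBoxIdeal, Set.image_image]
    congr 1
    refine Set.image_congr fun a _ => ?_
    rw [mixedBox_eq_prod, monomial_sum_one]
    rfl

lemma span_minGens {σ : Type} {I : Ideal (MvPolynomial σ k)} (hI : IsMonomialIdeal I) :
    Ideal.span ((fun a => monomial a (1 : k)) '' minGens I) = I := by
  apply le_antisymm
  · refine Ideal.span_le.mpr ?_
    rintro _ ⟨a, ha, rfl⟩
    exact ha.1
  · have key : ∀ w (a : σ →₀ ℕ), a.degree = w → a ∈ exponents I →
        a ∈ exponents (Ideal.span ((fun a => monomial a (1 : k)) '' minGens I)) := by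
      intro w
      induction w using Nat.strong_induction_on with
      | _ w ih =>
        intro a hw ha
        by_cases hmin : a ∈ minGens I
        · exact Ideal.subset_span ⟨a, hmin, rfl⟩
        · obtain ⟨i, hi, hmem⟩ := exists_sub_single_mem ha hmin
          have hle : Finsupp.single i 1 ≤ a := by
            rw [Finsupp.single_le_iff]
            omega
          have hdeg : (a - Finsupp.single i 1).degree + 1 = a.degree := by
            conv_rhs => rw [← tsub_add_cancel_of_le hle]
            simp
          exact mem_exponents_of_le (ih _ (by omega) _ rfl hmem) tsub_le_self
    obtain ⟨s, hs⟩ := hI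
    conv_lhs => rw [hs]
    refine Ideal.span_le.mpr ?_
    rintro _ ⟨a, ha, rfl⟩
    refine key _ a rfl ?_
    change monomial a (1 : k) ∈ I
    rw [hs]
    exact Ideal.subset_span ⟨a, ha, rfl⟩

/-- Row `i` contains exactly `a i` cells, none cut off at column `d` thanks to the degree bound. -/
lemma phi_mixedBox {a : Fin n →₀ ℕ} (ha : a.degree ≤ d) :
    phi k n d (mixedBox k d A a) = monomial a 1 := by
  have hrow : ∀ i, phi k n d (∏ j : Fin d with
      rowStart A a i ≤ j.val ∧ j.val < rowStart A a i + a i, X (i, j)) = X i ^ a i := by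
    intro i
    have hle := (rowStart_add_le_degree (A := A) a i).trans ha
    rw [map_prod]
    simp only [phi, aeval_X, Finset.prod_const]
    congr 1
    have : Finset.map Fin.valEmbedding ({j : Fin d | rowStart A a i ≤ j.val ∧
        j.val < rowStart A a i + a i} : Finset (Fin d)) =
        Finset.Ico (rowStart A a i) (rowStart A a i + a i) := by
      ext m
      simp only [Finset.mem_map, Finset.mem_filter, Finset.mem_univ, true_and,
        Fin.valEmbedding_apply, Finset.mem_Ico]
      constructor
      · rintro ⟨j, hj, rfl⟩
        exact hj
      · intro h
        exact ⟨⟨m, by omega⟩, h, rfl⟩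
    rw [← Finset.card_map Fin.valEmbedding, this, Nat.card_Ico]
    omega
  rw [mixedBox_eq_prod, cells, Finset.prod_filter, Fintype.prod_prod_type, map_prod,
    monomial_eq, C_1, one_mul, Finsupp.prod_fintype _ _ fun i => pow_zero _]
  refine Finset.prod_congr rfl fun i _ => ?_
  rw [← hrow i, Finset.prod_filter]

lemma map_phi_mixedBoxIdeal (hI : IsMonomialIdeal I) (hdeg : ∀ a ∈ minGens I, a.degree ≤ d) :
    (mixedBoxIdeal d A I).map (phi k n d) = I := by
  conv_rhs => rw [← span_minGens hI]
  rw [mixedBoxIdeal, Ideal.map_span, Set.image_image]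
  congr 1
  exact Set.image_congr fun a ha => phi_mixedBox (hdeg a ha)

lemma phi_surjective (hd : 1 ≤ d) : Function.Surjective (phi k n d) := by
  intro f
  refine ⟨rename (fun i => (i, (⟨0, hd⟩ : Fin d))) f, ?_⟩
  rw [phi, aeval_rename]
  exact aeval_X_left_apply f

/-- Modulo Θ, φ followed by the section `x_i ↦ x_{i,1}` is the identity. -/
lemma ker_phi (hd : 1 ≤ d) : RingHom.ker (phi k n d) = Ideal.span (theta k n d) := by
  apply le_antisymm
  · intro f hf
    have key : (Ideal.Quotient.mkₐ k (Ideal.span (theta k n d))).comp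
        ((rename fun i => (i, (⟨0, hd⟩ : Fin d))).comp (phi k n d)) =
          Ideal.Quotient.mkₐ k (Ideal.span (theta k n d)) := by
      refine MvPolynomial.algHom_ext fun v => ?_
      simp only [AlgHom.comp_apply, phi, aeval_X, rename_X]
      by_cases hv : 0 < v.2.val
      · exact Ideal.Quotient.eq.mpr (Ideal.subset_span ⟨v.1, ⟨0, hd⟩, v.2, rfl, hv, rfl⟩)
      · have : v = (v.1, ⟨0, hd⟩) := Prod.ext rfl (Fin.ext (by simp; omega))
        rw [← this]
    have := DFunLike.congr_fun key f
    rw [AlgHom.comp_apply, AlgHom.comp_apply, (RingHom.mem_ker).mp hf, map_zero, map_zero] at this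
    exact Ideal.Quotient.eq_zero_iff_mem.mp this.symm
  · refine Ideal.span_le.mpr ?_
    rintro _ ⟨i, j₁, j, -, -, rfl⟩
    simp [RingHom.mem_ker, phi]

/-- If `φ` maps `J` onto `I`, it identifies `S̃/(Θ) ⊗ S̃/J` with `S/I`. -/
lemma exists_specialization_equiv (hd : 1 ≤ d) {J : Ideal (PolRing k n d)}
    (hJ : J.map (phi k n d) = I) :
    ∃ e : ((PolRing k n d ⧸ Ideal.span (theta k n d)) ⊗[PolRing k n d]
      (PolRing k n d ⧸ J)) ≃+* (MvPolynomial (Fin n) k ⧸ I),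
    ∀ f g : PolRing k n d,
      e (Ideal.Quotient.mk _ f ⊗ₜ[PolRing k n d] Ideal.Quotient.mk _ g) =
        Ideal.Quotient.mk I (phi k n d (f * g)) := by
  let e₁ := (Algebra.TensorProduct.quotIdealMapEquivTensorQuot
    (PolRing k n d ⧸ Ideal.span (theta k n d)) J).symm.toRingEquiv
  let e₀ : (PolRing k n d ⧸ Ideal.span (theta k n d)) ≃+* MvPolynomial (Fin n) k :=
    (Ideal.quotEquivOfEq (ker_phi hd).symm).trans
      (RingHom.quotientKerEquivOfSurjective (phi_surjective hd))
  have he₀ : ∀ f, e₀ (Ideal.Quotient.mk _ f) = phi k n d f := fun f => rfl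
  have hmap : I = (J.map (algebraMap _ (PolRing k n d ⧸ Ideal.span (theta k n d)))).map
      (e₀ : _ →+* MvPolynomial (Fin n) k) := by
    rw [Ideal.map_map, ← hJ]
    rfl
  let e₂ := Ideal.quotientEquiv _ I e₀ hmap
  refine ⟨e₁.trans e₂, fun f g => ?_⟩
  have h₁ : e₁ (Ideal.Quotient.mk _ f ⊗ₜ[PolRing k n d] Ideal.Quotient.mk _ g) =
      Ideal.Quotient.mk _ (Ideal.Quotient.mk _ (f * g)) := by
    change Submodule.Quotient.mk (g • Ideal.Quotient.mk _ f) = _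
    rw [mul_comm]
    rfl
  rw [RingEquiv.trans_apply, h₁]
  rfl

end MixedBoxIdeal

end BoxPol

theorem theorem3p5 {k : Type*} [Field k] {n d : ℕ} (hd : 1 ≤ d)
    (I : Ideal (MvPolynomial (Fin n) k)) (hI : BoxPol.IsBorelFixed I)
    (hdeg : ∀ a ∈ BoxPol.minGens I, a.degree ≤ d) (A : Finset (Fin n)) :
    BoxPol.HasPrettyCleanFiltration (BoxPol.PolRing k n d)
        (BoxPol.PolRing k n d ⧸ BoxPol.mixedBoxIdeal d A I) ∧
      BoxPol.IsFaithfulPolarization I (BoxPol.mixedBoxIdeal d A I) := by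
  have hchain := hI.transversalChain (A := A) hdeg
  exact ⟨hchain.hasPrettyCleanFiltration,
    { squarefree := BoxPol.isSquarefreeMonomialIdeal_mixedBoxIdeal
      specialize := BoxPol.exists_specialization_equiv hd
        (BoxPol.map_phi_mixedBoxIdeal hI.1 hdeg)
      regular := hchain.formsRegularSequence
      ext_regular := hchain.formsRegularSequence_ext }⟩
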